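/- Let $(\mathcal X,d)$ be a complete separable metric space and $\mu$ a Borel probability measure on $\mathcal X$. For a Lipschitz function $f:\mathcal X\to\mathbb R$ put $|\nabla^- f|(x)=\limsup_{y\to x,\,y\neq x}\frac{[f(y)-f(x)]_-}{d(y,x)}$ (with $[X]_-=\max(-X,0)$, and $|\nabla^-f|(x)=0$ if $x$ is isolated). For $\lambda\in[0,+\infty]$, $\mu$ satisfies the Poincaré inequality with constant $\lambda$ if $$\lambda\,\mathrm{Var}_\mu(f)\le\int|\nabla^-f|^2\,d\mu\qquad\text{for every Lipschitz } f:\mathcal X\to\mathbb R,$$ with the convention $\infty\times 0=0$, the variance being taken in $[0,+\infty]$. The optimal constant $\lambda_\mu\in[0,+\infty]$ is the supremum of all such $\lambda$. For a metric space $Y$ with a probability measure $\nu$ and $t\in[0,1]$, $\mathrm{Part\,Diam}(Y,\nu,t)$ is the infimum of the diameters of the Borel sets $A\subset Y$ with $\nu(A)\ge 1-t$, and $\mathrm{Obs\,Diam}(Y,\nu,t)\in[0,+\infty]$ is the supremum of $\mathrm{Part\,Diam}(\mathbb R,\nu_f,t)$ over all $1$-Lipschitz $f:Y\to\mathbb R$,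 where $\nu_f$ is the push-forward of $\nu$ under $f$. On $\mathcal X^n$ let $d_2(x,y)=\big(\sum_{i=1}^n d(x_i,y_i)^2\big)^{1/2}$ and let $\mu^n$ be the product measure; put $$r_\infty(t)=\sup_{n\ge1}\mathrm{Obs\,Diam}(\mathcal X^n,d_2,\mu^n,t)\in[0,+\infty].$$ Let $\overline\Phi(x)=\frac1{\sqrt{2\pi}}\int_x^{\infty}e^{-u^2/2}\,du$. There are universal constants $a>0$ and $b\ge1$ such that, for all such $(\mathcal X,d)$ and $\mu$, the following hold. 1. $\mu$ satisfies the Poincaré inequality with the constant $\lambda_\mu$ (so $\lambda_\mu$ is the largest admissible constant). 2. $\mu$ satisfies the Poincaré inequality with some constant $\lambda>0$ if and only if $r_\infty(t)<\infty$ for some $t\in(0,1/2)$. 3. If $\lambda_\mu>0$, then for all $t\in(0,1/2)$ $$r_\infty(t)\sqrt{\lambda_\mu}\le a\log\Big(\frac bt\Big),$$ and, if moreover $\mu$ is not a Dirac mass, $$\overline\Phi^{-1}(t)\le r_\infty(t)\sqrt{\lambda_\mu}.$$ -/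

import Mathlib

open MeasureTheory ProbabilityTheory Set Filter Topology
open scoped NNReal ENNReal

noncomputable section

/-- The local slope `|∇⁻ f|(x) = limsup_{y → x} [f(y) - f(x)]₋ / d(y, x)`, as an extended nonnegative
real. Here `[f(y) - f(x)]₋ = max (f(x) - f(y)) 0`, and `y → x` with `y ≠ x`. At an isolated point
the punctured neighbourhood filter is trivial and the value is `0`. -/
def descSlope {X : Type*} [MetricSpace X] (f : X → ℝ) (x : X) : ℝ≥0∞ :=
  limsup (fun y => ENNReal.ofReal (f x - f y) / edist y x) (𝓝[≠] x)

/-- The Poincaré inequality with constant `lam ∈ [0, ∞]`: `lam * Var_μ(f) ≤ ∫ |∇⁻ f|² dμ` for all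
Lipschitz `f`, with the convention `∞ * 0 = 0`. The variance is taken in `[0, ∞]`; it is infinite
exactly when `f` is not square integrable. -/
def PoincareInequality {X : Type*} [MetricSpace X] [MeasurableSpace X] (μ : Measure X)
    (lam : ℝ≥0∞) : Prop :=
  ∀ f : X → ℝ, (∃ K : ℝ≥0, LipschitzWith K f) →
    lam * evariance f μ ≤ ∫⁻ x, descSlope f x ^ 2 ∂μ

/-- The optimal constant in the Poincaré inequality: the supremum of all admissible constants. -/
def poincareConst {X : Type*} [MetricSpace X] [MeasurableSpace X] (μ : Measure X) : ℝ≥0∞ :=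
  sSup {lam | PoincareInequality μ lam}

/-- The partial diameter: the infimum of the diameters of the (Borel) sets of measure at least
`1 - t`. -/
def partDiam {Y : Type*} [MetricSpace Y] [MeasurableSpace Y] (ν : Measure Y) (t : ℝ) : ℝ≥0∞ :=
  ⨅ (A : Set Y) (_ : MeasurableSet A) (_ : ENNReal.ofReal (1 - t) ≤ ν A), Metric.ediam A

/-- The observable diameter: the supremum over `1`-Lipschitz functions `f` of the partial diameter
of the law of `f` on the real line. -/
def obsDiam {Y : Type*} [MetricSpace Y] [MeasurableSpace Y] (ν : Measure Y) (t : ℝ) : ℝ≥0∞ :=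
  ⨆ (f : Y → ℝ) (_ : LipschitzWith 1 f), partDiam (ν.map f) t

/-- The product measure `μⁿ` on `Xⁿ` equipped with the `ℓ²` product distance `d₂`. -/
def powMeasure {X : Type*} [MeasurableSpace X] (μ : Measure X) (n : ℕ) :
    Measure (PiLp 2 (fun _ : Fin n => X)) :=
  (Measure.pi (fun _ : Fin n => μ)).map (WithLp.toLp 2)

/-- `r_∞(t) = sup_{n ≥ 1} ObsDiam(Xⁿ, d₂, μⁿ, t)`. -/
def obsDiamSup {X : Type*} [MetricSpace X] [MeasurableSpace X] (μ : Measure X) (t : ℝ) : ℝ≥0∞ :=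
  ⨆ (n : ℕ) (_ : 1 ≤ n), obsDiam (powMeasure μ n) t

/-- The tail function of the standard Gaussian measure. -/
def gaussTail (x : ℝ) : ℝ :=
  (√(2 * Real.pi))⁻¹ * ∫ u in Ioi x, Real.exp (-u ^ 2 / 2)

/-- The inverse of `gaussTail`, a continuous strictly decreasing bijection from `ℝ` onto `(0, 1)`:
for `t ∈ (0, 1)` the set below is the half-line `[s, ∞)`, where `gaussTail s = t`. -/
def gaussTailInv (t : ℝ) : ℝ := sInf {x : ℝ | gaussTail x ≤ t}

end

/-!
The proof combines two implications, each by an elementary argument on product spaces.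

*From Poincaré to concentration* (`measure_ge_le_exp`, `obsDiam_powMeasure_le`). The variance
tensorizes (`evariance_pi_le`), so a Poincaré inequality for `μ` bounds the variance of `h` under
`μⁿ` by the mean of the sum of the squared partial slopes of `h`. For a general Lipschitz function
this sum is not controlled by the square of the full slope. It is, however, for `h = exp (-s u / 2)`
where `u(x) = inf_{y ∈ B} √(δ² + d₂(x, y)²)`: moving one coordinate while keeping a near-minimizer
`y` fixed shows that the partial slopes of `h` are at most `(s / 2) h wᵢ` with `∑ wᵢ² ≤ 1`
(`exists_weights_smoothInfDist`). Hence `M(s) = ∫ exp (-s u) dμⁿ` satisfies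
`M(s) - M(s/2)² ≤ s² / (4λ) M(s)`, and iterating this at `s = √λ` bounds `M(s)` through the
behaviour of `M` near `0`. Taking `B = {F ≥ m + r}` for a `1`-Lipschitz `F` with median `m`, one has
`u ≥ r` on the set `{F ≤ m}` of mass one half, which gives `μⁿ(B) ≤ exp (2 - √λ r / 2)`, whatever `n`.

*From concentration to Poincaré* (`gaussTailInv_le_of_obsDiam_lt`,
`poincareInequality_of_obsDiam_lt`). If `r > r_∞(t)`, then every closed set of `μⁿ`-measure at least
`1/2` has an `r`-neighbourhood of measure at least `1 - t`. Apply this to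
`{∑ g(xᵢ) ≤ ε √n}`, where `g` is Lipschitz with mean `0` and variance `1`. On the neighbourhood,
`n^{-1/2} ∑ g(xᵢ)` exceeds `ε + r² / (2τ)` by at most the average of `R_n(xᵢ)`, where `R_n` is the
rescaled decrease of `g` under an infinitesimal inf-convolution (`convDecrease`). By the
Hamilton–Jacobi bound `limsup R_n ≤ (τ/2) |∇⁻g|²` (`limsup_convDecrease_le`), reverse Fatou and
Chebyshev, this average is asymptotically at most `(τ/2) ∫ |∇⁻g|² dμ`, while the normalized sum is
asymptotically Gaussian. Therefore `Φ̄⁻¹(t) ≤ (τ/2) ∫ |∇⁻g|² dμ + r² / (2τ)` for all `τ > 0`, and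
optimizing `τ` gives the Poincaré inequality with constant `(Φ̄⁻¹(t) / r)²`. Functions that are not
known to be square integrable are reached by truncation (`evariance_le_of_forall_truncation`).
-/

/-! ### Tensorization of the variance -/

theorem evariance_eq_lintegral_ofReal_sub {α : Type*} [MeasurableSpace α] (μ : Measure α)
    (f : α → ℝ) : evariance f μ = ∫⁻ x, ENNReal.ofReal ((f x - ∫ y, f y ∂μ) ^ 2) ∂μ :=
  evariance_eq_lintegral_ofReal f μ

theorem integrable_of_forall_abs_le {α : Type*} [MeasurableSpace α] (μ : Measure α)
    [IsProbabilityMeasure μ] {f : α → ℝ} (hf : Measurable f) {C : ℝ} (hC : ∀ x, |f x| ≤ C) :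
    Integrable f μ :=
  Integrable.of_bound hf.aestronglyMeasurable C (ae_of_all _ hC)

theorem memLp_of_forall_abs_le {α : Type*} [MeasurableSpace α] (μ : Measure α)
    [IsProbabilityMeasure μ] {f : α → ℝ} (hf : Measurable f) {C : ℝ} (hC : ∀ x, |f x| ≤ C)
    (p : ℝ≥0∞) : MemLp f p μ :=
  MemLp.of_bound hf.aestronglyMeasurable C (ae_of_all _ hC)

/-- The bias–variance decomposition, with the bias `∫ φ - ∫ h` estimated in `L²`. -/
theorem lintegral_sub_integral_sq_le {α : Type*} [MeasurableSpace α] (μ : Measure α)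
    [IsProbabilityMeasure μ] {φ h : α → ℝ} (hφ : Measurable φ) (hh : Measurable h) {C : ℝ}
    (hφC : ∀ x, |φ x| ≤ C) (hhC : ∀ x, |h x| ≤ C) :
    ∫⁻ x, ENNReal.ofReal ((φ x - ∫ y, h y ∂μ) ^ 2) ∂μ ≤
      evariance φ μ + ∫⁻ x, ENNReal.ofReal ((φ x - h x) ^ 2) ∂μ := by
  have iφ := integrable_of_forall_abs_le μ hφ hφC
  have ih := integrable_of_forall_abs_le μ hh hhC
  have mφ := memLp_of_forall_abs_le μ hφ hφC 2
  have mh := memLp_of_forall_abs_le μ hh hhC 2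
  have m1 : MemLp (fun x => φ x - ∫ y, h y ∂μ) 2 μ := mφ.sub (memLp_const _)
  have m2 : MemLp (fun x => φ x - h x) 2 μ := mφ.sub mh
  have e1 := variance_eq_sub m1
  have e2 := variance_eq_sub m2
  have e3 : variance (fun x => φ x - ∫ y, h y ∂μ) μ = variance φ μ :=
    variance_sub_const hφ.aestronglyMeasurable _
  have e4 := variance_nonneg (fun x => φ x - h x) μ
  rw [← ofReal_variance mφ, ← ofReal_integral_eq_lintegral_ofReal m1.integrable_sq
      (ae_of_all _ fun x => sq_nonneg _), ← ofReal_integral_eq_lintegral_ofReal m2.integrable_sq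
      (ae_of_all _ fun x => sq_nonneg _), ← ENNReal.ofReal_add (variance_nonneg _ _)
      (integral_nonneg fun x => sq_nonneg _)]
  apply ENNReal.ofReal_le_ofReal
  have e5 : ∫ x, (φ x - ∫ y, h y ∂μ) ∂μ = ∫ x, (φ x - h x) ∂μ := by
    rw [integral_sub iφ (integrable_const _), integral_sub iφ ih]; simp
  simp only [Pi.pow_apply] at e1 e2
  rw [e5] at e1
  linarith

/-- Two-factor subadditivity of the variance. -/
theorem evariance_prod_le {α β : Type*} [MeasurableSpace α] [MeasurableSpace β]
    (μ : Measure α) (ν : Measure β) [IsProbabilityMeasure μ] [IsProbabilityMeasure ν]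
    {f : α × β → ℝ} (hf : Measurable f) {C : ℝ} (hC : ∀ x, |f x| ≤ C) :
    evariance f (μ.prod ν) ≤ ∫⁻ y, evariance (fun x => f (x, y)) μ ∂ν +
      ∫⁻ x, evariance (fun y => f (x, y)) ν ∂μ := by
  set h : α → ℝ := fun x => ∫ y, f (x, y) ∂ν with hh
  have mh : Measurable h := (hf.stronglyMeasurable.integral_prod_right').measurable
  have hhC : ∀ x, |h x| ≤ C := fun x => by
    have := norm_integral_le_of_norm_le_const (μ := ν) (f := fun y => f (x, y)) (C := C)
      (ae_of_all _ fun y => hC (x, y))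
    simpa using this
  have if' := integrable_of_forall_abs_le (μ.prod ν) hf hC
  have em : ∫ z, f z ∂(μ.prod ν) = ∫ x, h x ∂μ := integral_prod _ if'
  have key : ∀ y, ∫⁻ x, ENNReal.ofReal ((f (x, y) - ∫ x, h x ∂μ) ^ 2) ∂μ ≤
      evariance (fun x => f (x, y)) μ + ∫⁻ x, ENNReal.ofReal ((f (x, y) - h x) ^ 2) ∂μ := fun y =>
    lintegral_sub_integral_sq_le μ (by fun_prop) mh (fun x => hC (x, y)) hhC
  have m2 : Measurable fun z : α × β => ENNReal.ofReal ((f z - h z.1) ^ 2) := by fun_prop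
  have m3 : Measurable fun z : α × β => ENNReal.ofReal ((f z - ∫ x, h x ∂μ) ^ 2) := by fun_prop
  calc evariance f (μ.prod ν)
      = ∫⁻ z, ENNReal.ofReal ((f z - ∫ x, h x ∂μ) ^ 2) ∂(μ.prod ν) := by
        rw [evariance_eq_lintegral_ofReal_sub, em]
    _ = ∫⁻ y, ∫⁻ x, ENNReal.ofReal ((f (x, y) - ∫ x, h x ∂μ) ^ 2) ∂μ ∂ν :=
        lintegral_prod_symm _ m3.aemeasurable
    _ ≤ ∫⁻ y, (evariance (fun x => f (x, y)) μ +
          ∫⁻ x, ENNReal.ofReal ((f (x, y) - h x) ^ 2) ∂μ) ∂ν := lintegral_mono key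
    _ = ∫⁻ y, evariance (fun x => f (x, y)) μ ∂ν +
          ∫⁻ y, ∫⁻ x, ENNReal.ofReal ((f (x, y) - h x) ^ 2) ∂μ ∂ν :=
        lintegral_add_right _ m2.lintegral_prod_left'
    _ = _ := by
        congr 1
        rw [← lintegral_prod_symm _ m2.aemeasurable, lintegral_prod _ m2.aemeasurable]
        refine lintegral_congr fun x => ?_
        rw [evariance_eq_lintegral_ofReal_sub]

/-- Tensorization: if in each coordinate separately the variance of `f` is controlled by an
energy `G i`, then the variance of `f` for the product measure is controlled by the total energy.
This is the Efron–Stein inequality, with the energies built in. -/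
theorem evariance_pi_le {α : Type*} [MeasurableSpace α] (μ : Measure α) [IsProbabilityMeasure μ]
    {c : ℝ≥0∞} (hc : c ≠ ∞) {C : ℝ} (n : ℕ) {f : (Fin n → α) → ℝ} (hf : Measurable f)
    (hC : ∀ x, |f x| ≤ C) {G : Fin n → (Fin n → α) → ℝ≥0∞} (hG : ∀ i, Measurable (G i))
    (h : ∀ x i, c * evariance (fun y => f (Function.update x i y)) μ ≤
      ∫⁻ y, G i (Function.update x i y) ∂μ) :
    c * evariance f (Measure.pi fun _ => μ) ≤ ∑ i, ∫⁻ x, G i x ∂(Measure.pi fun _ => μ) := by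
  induction n with
  | zero =>
    have : evariance f (Measure.pi fun _ => μ) = 0 := by
      rw [evariance_eq_zero_iff hf.aemeasurable]
      refine ae_of_all _ fun x => ?_
      have : f = fun _ => f x := funext fun y => congrArg f (Subsingleton.elim _ _)
      rw [this]; simp
    simp [this]
  | succ n ih =>
    set ν : Measure (Fin n → α) := Measure.pi fun _ => μ
    have mp := (measurePreserving_piFinSuccAbove (fun _ : Fin (n + 1) => μ) 0).symm
    set e := (MeasurableEquiv.piFinSuccAbove (fun _ : Fin (n + 1) => α) 0).symm
    have he : ∀ z, e z = Fin.cons z.1 z.2 := fun z => by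
      simp [e, MeasurableEquiv.piFinSuccAbove]; rfl
    have me : Measurable e := e.measurable
    have hlint : ∀ g : (Fin (n + 1) → α) → ℝ≥0∞, Measurable g →
        ∫⁻ x, g x ∂(Measure.pi fun _ => μ) = ∫⁻ z, g (e z) ∂(μ.prod ν) := fun g hg =>
      (mp.lintegral_comp hg).symm
    have hint : ∫ x, f x ∂(Measure.pi fun _ => μ) = ∫ z, f (e z) ∂(μ.prod ν) :=
      (mp.integral_comp' f).symm
    have h1 : evariance f (Measure.pi fun _ => μ) = evariance (fun z => f (e z)) (μ.prod ν) := by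
      rw [evariance_eq_lintegral_ofReal_sub, hlint _ (by fun_prop), hint,
        evariance_eq_lintegral_ofReal_sub]
    rw [h1]
    have hfe : Measurable fun z => f (e z) := hf.comp me
    have hGe : ∀ i, Measurable fun z => G i (e z) := fun i => (hG i).comp me
    calc c * evariance (fun z => f (e z)) (μ.prod ν)
        ≤ c * (∫⁻ y, evariance (fun x => f (e (x, y))) μ ∂ν +
          ∫⁻ x, evariance (fun y => f (e (x, y))) ν ∂μ) := by
          gcongr; exact evariance_prod_le μ ν hfe (fun z => hC _)
      _ ≤ ∫⁻ y, c * evariance (fun x => f (e (x, y))) μ ∂ν +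
          ∫⁻ x, c * evariance (fun y => f (e (x, y))) ν ∂μ := by
          rw [mul_add, lintegral_const_mul' _ _ hc, lintegral_const_mul' _ _ hc]
      _ ≤ ∫⁻ y, ∫⁻ x, G 0 (e (x, y)) ∂μ ∂ν +
          ∫⁻ x, ∑ i : Fin n, ∫⁻ y, G i.succ (e (x, y)) ∂ν ∂μ := by
          gcongr with y x
          · obtain ⟨x0⟩ := μ.nonempty_of_neZero
            simpa [he] using h (Fin.cons x0 y) 0
          · refine ih (f := fun y => f (e (x, y))) (G := fun i y => G i.succ (e (x, y)))
              (by fun_prop) (fun y => hC _) (fun i => by fun_prop) fun y i => ?_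
            simpa [he, Fin.cons_update] using h (Fin.cons x y) i.succ
      _ = _ := by
          rw [Fin.sum_univ_succ, lintegral_finsetSum _ fun i _ => ?_]
          · congr 1
            · rw [hlint _ (hG 0), lintegral_prod_symm _ (hGe 0).aemeasurable]
            · refine Finset.sum_congr rfl fun i _ => ?_
              rw [hlint _ (hG i.succ), lintegral_prod _ (hGe i.succ).aemeasurable]
          · exact (hGe i.succ).lintegral_prod_right'

/-! ### Measurability of slopes -/

theorem limsup_nhdsNE_eq {Y : Type*} [MetricSpace Y] (u : Y → ℝ≥0∞) (x : Y) :
    limsup u (𝓝[≠] x) =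
      ⨅ k : ℕ, ⨆ y : Y, ⨆ _ : y ≠ x ∧ dist y x < 1 / ((k : ℝ) + 1), u y := by
  have hb := nhdsWithin_hasBasis (Metric.nhds_basis_ball_inv_nat_succ (x := x)) {x}ᶜ
  rw [hb.limsup_eq_iInf_iSup]
  simp only [iInf_pos]
  refine iInf_congr fun k => iSup_congr fun y => ?_
  refine iSup_congr_Prop ?_ fun _ => rfl
  simp [and_comm]

/-- The slope of a continuous function in one of its variables, the others being parameters, is
a measurable function of all variables: for each radius the supremum of the difference
quotients is lower semicontinuous. -/
theorem measurable_limsup_slope {Z Y : Type*} [TopologicalSpace Z] [MeasurableSpace Z]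
    [OpensMeasurableSpace Z] [MetricSpace Y] {p : Z → Y} (hp : Continuous p) {f : Z → ℝ}
    (hf : Continuous f) {g : Y → Z → ℝ} (hg : ∀ y, Continuous (g y)) :
    Measurable fun z =>
      limsup (fun y => ENNReal.ofReal (f z - g y z) / edist y (p z)) (𝓝[≠] (p z)) := by
  simp_rw [limsup_nhdsNE_eq]
  refine Measurable.iInf fun k => LowerSemicontinuous.measurable ?_
  refine lowerSemicontinuous_iSup fun y => ?_
  intro z a ha
  by_cases hz : y ≠ p z ∧ dist y (p z) < 1 / ((k : ℝ) + 1)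
  · have hc : ContinuousAt (fun z => ENNReal.ofReal ((f z - g y z) / dist y (p z))) z := by
      have hd : ContinuousAt (fun z => dist y (p z)) z := by fun_prop
      have h1 : ContinuousAt (fun z => f z - g y z) z := (hf.sub (hg y)).continuousAt
      exact ENNReal.continuous_ofReal.continuousAt.comp (h1.div hd (dist_pos.2 hz.1).ne')
    have hopen : IsOpen {z | y ≠ p z ∧ dist y (p z) < 1 / ((k : ℝ) + 1)} :=
      (isOpen_ne_fun continuous_const hp).inter
        (isOpen_lt (continuous_const.dist hp) continuous_const)
    have heq : ∀ z', y ≠ p z' → ENNReal.ofReal (f z' - g y z') / edist y (p z') =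
        ENNReal.ofReal ((f z' - g y z') / dist y (p z')) := fun z' hz' => by
      rw [edist_dist, ENNReal.ofReal_div_of_pos (dist_pos.2 hz')]
    simp only [iSup_pos hz, heq z hz.1] at ha
    filter_upwards [hc.eventually (lt_mem_nhds ha), hopen.mem_nhds hz] with z' h1 h2
    rwa [iSup_pos h2, heq z' h2.1]
  · beta_reduce at ha
    rw [iSup_neg hz] at ha
    exact absurd ha not_lt_bot

/-! ### Smoothed distance functions -/

/-- The smoothed distance `q ↦ √(δ² + d(p, q)²)`, minimized over `q ∈ B`. -/
noncomputable def smoothInfDist {E : Type*} [MetricSpace E] (δ : ℝ) (B : Set E) (p : E) : ℝ :=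
  ⨅ q : B, √(δ ^ 2 + dist p q ^ 2)

section smooth

variable {E : Type*} [MetricSpace E] {δ : ℝ} {B : Set E}

theorem bddBelow_range_sqrt (δ : ℝ) (B : Set E) (p : E) :
    BddBelow (range fun q : B => √(δ ^ 2 + dist p q ^ 2)) :=
  ⟨0, by rintro _ ⟨q, rfl⟩; exact Real.sqrt_nonneg _⟩

theorem smoothInfDist_le (δ : ℝ) (p : E) {q : E} (hq : q ∈ B) :
    smoothInfDist δ B p ≤ √(δ ^ 2 + dist p q ^ 2) :=
  ciInf_le (bddBelow_range_sqrt δ B p) ⟨q, hq⟩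

theorem smoothInfDist_nonneg (δ : ℝ) (B : Set E) (p : E) : 0 ≤ smoothInfDist δ B p :=
  Real.iInf_nonneg fun _ => Real.sqrt_nonneg _

theorem smoothInfDist_le_of_mem (hδ : 0 ≤ δ) {p : E} (hp : p ∈ B) : smoothInfDist δ B p ≤ δ := by
  simpa [Real.sqrt_sq hδ] using smoothInfDist_le δ p hp

theorem le_smoothInfDist (hB : B.Nonempty) {p : E} {r : ℝ} (h : ∀ q ∈ B, r ≤ dist p q) :
    r ≤ smoothInfDist δ B p := by
  have := hB.to_subtype
  refine le_ciInf fun q => (h q q.2).trans ?_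
  exact Real.le_sqrt_of_sq_le (by nlinarith [sq_nonneg δ])

theorem smoothInfDist_le_add (hB : B.Nonempty) (p p' : E) :
    smoothInfDist δ B p ≤ smoothInfDist δ B p' + dist p p' := by
  have := hB.to_subtype
  rw [← sub_le_iff_le_add]
  refine le_ciInf fun q => ?_
  rw [sub_le_iff_le_add]
  refine (smoothInfDist_le δ p q.2).trans ?_
  have h1 : dist p q ≤ dist p' q + dist p p' := by linarith [dist_triangle p p' q]
  have h0 := Real.sqrt_nonneg (δ ^ 2 + dist p' q ^ 2)
  have h2 : dist p' q ≤ √(δ ^ 2 + dist p' q ^ 2) :=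
    Real.le_sqrt_of_sq_le (by nlinarith [sq_nonneg δ])
  have h3 := Real.sq_sqrt (show 0 ≤ δ ^ 2 + dist p' q ^ 2 by positivity)
  have h4 : dist p q ^ 2 ≤ (dist p' q + dist p p') ^ 2 := by gcongr
  have h5 := mul_le_mul_of_nonneg_right h2 (dist_nonneg (x := p) (y := p'))
  apply Real.sqrt_le_iff.2
  constructor
  · positivity
  · nlinarith

theorem lipschitzWith_smoothInfDist (δ : ℝ) (hB : B.Nonempty) :
    LipschitzWith 1 (smoothInfDist δ B) :=
  LipschitzWith.of_le_add fun p p' => smoothInfDist_le_add hB p p'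

end smooth

theorem piLp_dist_sq {X : Type*} [MetricSpace X] {n : ℕ} (p q : PiLp 2 fun _ : Fin n => X) :
    dist p q ^ 2 = ∑ i, dist (p i) (q i) ^ 2 := by
  rw [PiLp.dist_eq_sum (by norm_num)]
  have h : 0 ≤ ∑ i, dist (p i) (q i) ^ 2 := by positivity
  simp only [ENNReal.toReal_ofNat, Real.rpow_ofNat]
  rw [← Real.sqrt_eq_rpow, Real.sq_sqrt h]

theorem piLp_dist_sq_update {X : Type*} [MetricSpace X] {n : ℕ} (x : Fin n → X) (i : Fin n)
    (z : X) (q : PiLp 2 fun _ : Fin n => X) :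
    dist (WithLp.toLp 2 (Function.update x i z)) q ^ 2 =
      dist (WithLp.toLp 2 x) q ^ 2 - dist (x i) (q i) ^ 2 + dist z (q i) ^ 2 := by
  simp only [piLp_dist_sq]
  rw [← Finset.add_sum_erase _ _ (Finset.mem_univ i),
    ← Finset.add_sum_erase (a := i) _ (fun j => dist ((WithLp.toLp 2 x) j) (q j) ^ 2)
      (Finset.mem_univ i)]
  have : ∑ j ∈ Finset.univ.erase i, dist ((WithLp.toLp 2 (Function.update x i z)) j) (q j) ^ 2 =
      ∑ j ∈ Finset.univ.erase i, dist ((WithLp.toLp 2 x) j) (q j) ^ 2 := by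
    refine Finset.sum_congr rfl fun j hj => ?_
    simp [Finset.ne_of_mem_erase hj]
  rw [this]
  simp
  ring

theorem piLp_dist_update {X : Type*} [MetricSpace X] {n : ℕ} (x : Fin n → X) (i : Fin n)
    (z z' : X) :
    dist (WithLp.toLp 2 (Function.update x i z)) (WithLp.toLp 2 (Function.update x i z')) =
      dist z z' := by
  rw [← sq_eq_sq₀ dist_nonneg dist_nonneg, piLp_dist_sq,
    Finset.sum_eq_single_of_mem i (Finset.mem_univ i)]
  · simp
  · intro j _ hj
    simp [hj]

/-- The increments of the smoothed distance along the coordinate axes are controlled, up to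
second order, by a single vector of Euclidean norm at most one. The vector is a limit of unit
directions towards near-minimizers, so that no minimizer needs to exist. -/
theorem exists_weights_smoothInfDist {X : Type*} [MetricSpace X] {n : ℕ} {δ : ℝ} (hδ : 0 < δ)
    {B : Set (PiLp 2 fun _ : Fin n => X)} (hB : B.Nonempty) (x : Fin n → X) :
    ∃ w : Fin n → ℝ, (∀ i, 0 ≤ w i) ∧ ∑ i, w i ^ 2 ≤ 1 ∧ ∀ i z,
      smoothInfDist δ B (WithLp.toLp 2 (Function.update x i z)) ≤
        smoothInfDist δ B (WithLp.toLp 2 x) + dist z (x i) * w i + dist z (x i) ^ 2 / (2 * δ) := by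
  have := hB.to_subtype
  set p : PiLp 2 fun _ : Fin n => X := WithLp.toLp 2 x with hp
  obtain ⟨v, -, hv, hvm⟩ := exists_seq_tendsto_sInf
    (range_nonempty fun q : B => √(δ ^ 2 + dist p q ^ 2)) (bddBelow_range_sqrt δ B p)
  choose q hq using hvm
  change Tendsto v atTop (𝓝 (smoothInfDist δ B p)) at hv
  simp only at hq
  have hS0 : ∀ k, δ ≤ v k := fun k => by
    rw [← hq]; exact Real.le_sqrt_of_sq_le (by nlinarith [sq_nonneg (dist p (q k))])
  have hSsq : ∀ k, v k ^ 2 = δ ^ 2 + dist p (q k) ^ 2 := fun k => by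
    rw [← hq, Real.sq_sqrt (by positivity)]
  have hpos : ∀ k, 0 < v k := fun k => hδ.trans_le (hS0 k)
  set w : ℕ → Fin n → ℝ := fun k i => dist (x i) ((q k : PiLp 2 fun _ : Fin n => X) i) / v k
  have hw0 : ∀ k i, 0 ≤ w k i := fun k i => div_nonneg dist_nonneg (hpos k).le
  have hwsum : ∀ k, ∑ i, w k i ^ 2 ≤ 1 := fun k => by
    simp only [w, div_pow]
    rw [← Finset.sum_div, div_le_one (by have := hpos k; positivity), hSsq, piLp_dist_sq]
    simp [hp, sq_nonneg]
  have hw1 : ∀ k i, w k i ≤ 1 := fun k i => by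
    have := (Finset.single_le_sum (f := fun i => w k i ^ 2) (fun j _ => sq_nonneg _)
      (Finset.mem_univ i)).trans (hwsum k)
    exact (sq_le_one_iff₀ (hw0 k i)).1 this
  obtain ⟨a, -, φ, hφ, ha⟩ := (isCompact_Icc (a := (0 : Fin n → ℝ)) (b := 1)).tendsto_subseq
    (x := w) fun k => ⟨fun i => hw0 k i, fun i => hw1 k i⟩
  have hai : ∀ i, Tendsto (fun k => w (φ k) i) atTop (𝓝 (a i)) := fun i => (tendsto_pi_nhds.1 ha) i
  refine ⟨a, fun i => ge_of_tendsto' (hai i) fun k => hw0 _ i, ?_, fun i z => ?_⟩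
  · exact le_of_tendsto' (tendsto_finsetSum _ fun i _ => (hai i).pow 2) fun k => hwsum _
  · refine ge_of_tendsto' (((hv.comp hφ.tendsto_atTop).add ((hai i).const_mul _)).add_const _)
      fun k => ?_
    simp only [Function.comp]
    set k' := φ k
    refine (smoothInfDist_le δ _ (q k').2).trans ?_
    have h1 := piLp_dist_sq_update x i z (q k' : PiLp 2 fun _ : Fin n => X)
    set t := dist z (x i)
    set b := dist (x i) ((q k' : PiLp 2 fun _ : Fin n => X) i)
    have ht : 0 ≤ t := dist_nonneg
    have hb : 0 ≤ b := dist_nonneg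
    have h2 : dist z ((q k' : PiLp 2 fun _ : Fin n => X) i) ≤ t + b := dist_triangle _ _ _
    have h3 : dist z ((q k' : PiLp 2 fun _ : Fin n => X) i) ^ 2 ≤ (t + b) ^ 2 := by gcongr
    have h4 : v k' * (t * w k' i) = t * b := by
      simp only [w]; field_simp [(hpos k').ne']; rfl
    have h5 : t ^ 2 / 2 ≤ v k' * (t ^ 2 / (2 * δ)) := by
      have : δ * (t ^ 2 / (2 * δ)) = t ^ 2 / 2 := by field_simp
      rw [← this]; exact mul_le_mul_of_nonneg_right (hS0 k') (by positivity)
    have h6 := hSsq k'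
    have h7 : 0 ≤ t * w k' i + t ^ 2 / (2 * δ) :=
      add_nonneg (mul_nonneg ht (hw0 _ _)) (by positivity)
    apply Real.sqrt_le_iff.2
    constructor
    · have := hpos k'; linarith
    · rw [h1]
      nlinarith [sq_nonneg (t * w k' i + t ^ 2 / (2 * δ))]

/-- A first-order bound on the decrease of a function bounds its descending slope. -/
theorem descSlope_le_of_forall {Y : Type*} [MetricSpace Y] {φ : Y → ℝ} {x : Y} {A C : ℝ}
    (h : ∀ y, φ x - φ y ≤ A * dist y x + C * dist y x ^ 2) :
    descSlope φ x ≤ ENNReal.ofReal A := by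
  have hlim : Tendsto (fun y => ENNReal.ofReal (A + C * dist y x)) (𝓝[≠] x)
      (𝓝 (ENNReal.ofReal A)) := by
    have : Continuous fun y => ENNReal.ofReal (A + C * dist y x) :=
      ENNReal.continuous_ofReal.comp (by fun_prop)
    simpa using (this.tendsto x).mono_left nhdsWithin_le_nhds
  rcases (𝓝[≠] x).eq_or_neBot with hbot | hne
  · simp [descSlope, hbot]
  · rw [← hlim.limsup_eq]
    refine limsup_le_limsup ?_
    filter_upwards [self_mem_nhdsWithin] with y hy
    have hd : 0 < dist y x := dist_pos.2 hy
    rw [edist_dist, ← ENNReal.ofReal_div_of_pos hd]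
    apply ENNReal.ofReal_le_ofReal
    rw [div_le_iff₀ hd]
    linarith [h y]

/-! ### Exponential moments under the Poincaré inequality -/

/-- The Poincaré inequality tensorizes for exponentials of smoothed distances: the partial slopes
are controlled by a unit vector. -/
theorem integral_exp_sub_sq_le {X : Type*} [MetricSpace X] [SecondCountableTopology X]
    [MeasurableSpace X] [BorelSpace X] (μ : Measure X) [IsProbabilityMeasure μ] {lam : ℝ}
    (hlam : 0 < lam) (hP : PoincareInequality μ (ENNReal.ofReal lam)) {n : ℕ} {δ : ℝ} (hδ : 0 < δ)
    {B : Set (PiLp 2 fun _ : Fin n => X)} (hB : B.Nonempty) {s : ℝ} (hs : 0 < s) :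
    ∫ x, Real.exp (-(s * smoothInfDist δ B (WithLp.toLp 2 x))) ∂(Measure.pi fun _ => μ) -
      (∫ x, Real.exp (-(s / 2 * smoothInfDist δ B (WithLp.toLp 2 x)))
        ∂(Measure.pi fun _ => μ)) ^ 2 ≤
      s ^ 2 / (4 * lam) *
        ∫ x, Real.exp (-(s * smoothInfDist δ B (WithLp.toLp 2 x))) ∂(Measure.pi fun _ => μ) := by
  set π : Measure (Fin n → X) := Measure.pi fun _ => μ
  set u : (Fin n → X) → ℝ := fun x => smoothInfDist δ B (WithLp.toLp 2 x) with hu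
  set f : (Fin n → X) → ℝ := fun x => Real.exp (-(s / 2 * u x)) with hf
  have hu0 : ∀ x, 0 ≤ u x := fun x => smoothInfDist_nonneg δ B _
  have hucont : Continuous u :=
    (lipschitzWith_smoothInfDist δ hB).continuous.comp (PiLp.continuous_toLp 2 _)
  have hfcont : Continuous f := by fun_prop
  have hfC : ∀ x, |f x| ≤ 1 := fun x => by
    rw [abs_of_pos (Real.exp_pos _), Real.exp_le_one_iff]
    have := mul_nonneg hs.le (hu0 x)
    linarith
  have hdec : ∀ x x', f x - f x' ≤ f x * (s / 2) * (u x' - u x) := fun x x' => by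
    have h1 : f x' = f x * Real.exp (-(s / 2 * (u x' - u x))) := by
      rw [hf, ← Real.exp_add]; ring_nf
    have h2 := Real.add_one_le_exp (-(s / 2 * (u x' - u x)))
    have h3 : 0 < f x := Real.exp_pos _
    rw [h1]
    nlinarith
  set G : Fin n → (Fin n → X) → ℝ≥0∞ := fun i x =>
    descSlope (fun y => f (Function.update x i y)) (x i) ^ 2 with hG
  have hGm : ∀ i, Measurable (G i) := fun i => by
    refine Measurable.pow_const ?_ 2
    simp only [descSlope, Function.update_eq_self]
    exact measurable_limsup_slope (p := fun x : Fin n → X => x i) (continuous_apply i) hfcont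
      (g := fun y x => f (Function.update x i y))
      fun y => hfcont.comp (continuous_id.update i continuous_const)
  have hGle : ∀ x, ∑ i, G i x ≤ ENNReal.ofReal (s ^ 2 / 4 * f x ^ 2) := fun x => by
    obtain ⟨w, hw0, hw1, hw⟩ := exists_weights_smoothInfDist hδ hB x
    have hfs : 0 < f x * (s / 2) := mul_pos (Real.exp_pos _) (by positivity)
    have h1 : ∀ i, G i x ≤ ENNReal.ofReal ((f x * (s / 2) * w i) ^ 2) := fun i => by
      have h0 : 0 ≤ f x * (s / 2) * w i := mul_nonneg hfs.le (hw0 i)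
      rw [ENNReal.ofReal_pow h0]
      refine pow_le_pow_left' (descSlope_le_of_forall (C := f x * (s / 2) / (2 * δ)) ?_) 2
      intro y
      rw [Function.update_eq_self]
      refine (hdec _ _).trans ?_
      have h2 : u (Function.update x i y) - u x ≤
          dist y (x i) * w i + dist y (x i) ^ 2 / (2 * δ) := by
        have := hw i y
        simp only [hu]; linarith
      calc _ ≤ f x * (s / 2) * (dist y (x i) * w i + dist y (x i) ^ 2 / (2 * δ)) := by gcongr
        _ = _ := by ring
    calc ∑ i, G i x ≤ ∑ i, ENNReal.ofReal ((f x * (s / 2) * w i) ^ 2) :=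
          Finset.sum_le_sum fun i _ => h1 i
      _ = ENNReal.ofReal (∑ i, (f x * (s / 2) * w i) ^ 2) :=
          (ENNReal.ofReal_sum_of_nonneg fun i _ => sq_nonneg _).symm
      _ ≤ _ := by
          apply ENNReal.ofReal_le_ofReal
          simp only [mul_pow _ (w _)]
          rw [← Finset.mul_sum]
          have := mul_le_mul_of_nonneg_left hw1 (sq_nonneg (f x * (s / 2)))
          linarith
  have hfi : Integrable (fun x => f x ^ 2) π :=
    (memLp_of_forall_abs_le π hfcont.measurable hfC 2).integrable_sq
  have hmain : ENNReal.ofReal lam * evariance f π ≤ ENNReal.ofReal (∫ x, s ^ 2 / 4 * f x ^ 2 ∂π) :=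
    calc ENNReal.ofReal lam * evariance f π ≤ ∑ i, ∫⁻ x, G i x ∂π := by
          refine evariance_pi_le μ ENNReal.ofReal_ne_top n hfcont.measurable hfC hGm fun x i => ?_
          have hLip : LipschitzWith (Real.toNNReal (s / 2))
              fun y => f (Function.update x i y) := by
            refine LipschitzWith.of_le_add_mul _ fun y y' => ?_
            rw [Real.coe_toNNReal _ (by positivity)]
            have h1 := hdec (Function.update x i y) (Function.update x i y')
            have h2 := smoothInfDist_le_add (δ := δ) hB
              (WithLp.toLp 2 (Function.update x i y')) (WithLp.toLp 2 (Function.update x i y))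
            rw [piLp_dist_update, dist_comm] at h2
            have h3 : f (Function.update x i y) * (s / 2) *
                (u (Function.update x i y') - u (Function.update x i y)) ≤ s / 2 * dist y y' := by
              have h4 : f (Function.update x i y) ≤ 1 := (le_abs_self _).trans (hfC _)
              have h5 : 0 < f (Function.update x i y) := Real.exp_pos _
              calc _ ≤ f (Function.update x i y) * (s / 2) * dist y y' := by
                    gcongr; simp only [hu]; linarith
                _ ≤ 1 * (s / 2) * dist y y' := by gcongr
                _ = _ := by ring
            linarith
          refine (hP _ ⟨_, hLip⟩).trans_eq (lintegral_congr fun y => ?_)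
          simp [hG]
      _ = ∫⁻ x, ∑ i, G i x ∂π := (lintegral_finsetSum _ fun i _ => hGm i).symm
      _ ≤ ∫⁻ x, ENNReal.ofReal (s ^ 2 / 4 * f x ^ 2) ∂π := lintegral_mono hGle
      _ = _ := (ofReal_integral_eq_lintegral_ofReal (hfi.const_mul _)
          (ae_of_all _ fun x => by positivity)).symm
  have hfm := memLp_of_forall_abs_le π hfcont.measurable hfC 2
  rw [← ofReal_variance hfm, ← ENNReal.ofReal_mul hlam.le, integral_const_mul,
    ENNReal.ofReal_le_ofReal_iff (mul_nonneg (by positivity)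
      (integral_nonneg fun x => sq_nonneg _)), variance_eq_sub hfm] at hmain
  have hsq : ∀ x, f x ^ 2 = Real.exp (-(s * u x)) := fun x => by
    rw [hf, ← Real.exp_nat_mul]; push_cast; ring_nf
  simp only [Pi.pow_apply, hsq] at hmain
  rw [div_mul_eq_mul_div, le_div_iff₀ (by positivity)]
  linarith

/-- Iterating `M(s) - M(s/2)² ≤ s²/(4λ) M(s)`: the function `exp(-s²/λ) M(s)` is at most the square
of its value at `s/2`. -/
theorem le_exp_mul_pow_of_sub_sq_le {M : ℝ → ℝ} {lam : ℝ} (hlam : 0 < lam) (hM : ∀ s, 0 ≤ M s)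
    (h : ∀ s, 0 < s → M s - M (s / 2) ^ 2 ≤ s ^ 2 / (4 * lam) * M s) (m : ℕ) {s : ℝ} (hs : 0 < s)
    (hsl : s ^ 2 ≤ lam) : M s ≤ Real.exp (s ^ 2 / lam) * M (s / 2 ^ m) ^ 2 ^ m := by
  induction m generalizing s with
  | zero =>
    have : 1 ≤ Real.exp (s ^ 2 / lam) := Real.one_le_exp (by positivity)
    simpa using le_mul_of_one_le_left (hM s) this
  | succ m ih =>
    have ih' := ih (s := s / 2) (by positivity) (by nlinarith)
    set v := s ^ 2 / (4 * lam) with hv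
    have hv0 : 0 ≤ v := by positivity
    have hv1 : v ≤ 1 / 4 := by
      rw [hv, div_le_iff₀ (by positivity)]; linarith
    have h1 : (1 - v) * M s ≤ M (s / 2) ^ 2 := by linarith [h s hs]
    have h2 : 1 ≤ Real.exp (2 * v) * (1 - v) := by
      have := Real.add_one_le_exp (2 * v)
      nlinarith
    have h3 : M s ≤ Real.exp (2 * v) * M (s / 2) ^ 2 :=
      calc M s = 1 * M s := (one_mul _).symm
        _ ≤ Real.exp (2 * v) * (1 - v) * M s := mul_le_mul_of_nonneg_right h2 (hM s)
        _ = Real.exp (2 * v) * ((1 - v) * M s) := by ring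
        _ ≤ _ := by gcongr
    have h4 : M (s / 2) ^ 2 ≤ (Real.exp ((s / 2) ^ 2 / lam) * M (s / 2 / 2 ^ m) ^ 2 ^ m) ^ 2 :=
      pow_le_pow_left₀ (hM _) ih' 2
    refine h3.trans ((mul_le_mul_of_nonneg_left h4 (Real.exp_pos _).le).trans_eq ?_)
    rw [mul_pow, ← mul_assoc, ← Real.exp_nat_mul, ← Real.exp_add, ← pow_mul, ← pow_succ,
      div_div, ← pow_succ']
    congr 2
    rw [hv]; push_cast; field_simp; ring

/-- Exponential concentration: under the Poincaré inequality, a `1`-Lipschitz function on the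
`ℓ²`-product exceeds `m + r` with exponentially small probability, as soon as it is at most `m` with
probability one half. -/
theorem measure_ge_le_exp {X : Type*} [MetricSpace X] [SecondCountableTopology X]
    [MeasurableSpace X] [BorelSpace X] (μ : Measure X) [IsProbabilityMeasure μ] {lam : ℝ}
    (hlam : 0 < lam) (hP : PoincareInequality μ (ENNReal.ofReal lam)) {n : ℕ}
    {F : (PiLp 2 fun _ : Fin n => X) → ℝ} (hF : LipschitzWith 1 F) {m r : ℝ} (hr : 0 ≤ r)
    (hm : 1 / 2 ≤ (Measure.pi fun _ : Fin n => μ).real {x | F (WithLp.toLp 2 x) ≤ m}) :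
    (Measure.pi fun _ : Fin n => μ).real {x | m + r ≤ F (WithLp.toLp 2 x)} ≤
      Real.exp (2 - √lam * r / 2) := by
  set π : Measure (Fin n → X) := Measure.pi fun _ => μ
  set B : Set (PiLp 2 fun _ : Fin n => X) := {p | m + r ≤ F p} with hBdef
  rcases B.eq_empty_or_nonempty with hB | hB
  · have : {x | m + r ≤ F (WithLp.toLp 2 x)} = (∅ : Set (Fin n → X)) := by
      ext x
      have : WithLp.toLp 2 x ∉ B := hB ▸ notMem_empty _
      simpa [hBdef] using this
    rw [this]; simp [Real.exp_nonneg]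
  set s := √lam with hsdef
  have hs : 0 < s := Real.sqrt_pos.2 hlam
  have hs2 : s ^ 2 = lam := Real.sq_sqrt hlam.le
  -- with this smoothing, `exp (-s u)` is still at least `exp (-1)` on `B`
  set δ := 1 / s with hδdef
  have hδ : 0 < δ := by positivity
  set u : (Fin n → X) → ℝ := fun x => smoothInfDist δ B (WithLp.toLp 2 x) with hu
  have hu0 : ∀ x, 0 ≤ u x := fun x => smoothInfDist_nonneg δ B _
  have hFcont : Continuous fun x : Fin n → X => F (WithLp.toLp 2 x) :=
    hF.continuous.comp (PiLp.continuous_toLp 2 _)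
  have hucont : Continuous u :=
    (lipschitzWith_smoothInfDist δ hB).continuous.comp (PiLp.continuous_toLp 2 _)
  have hint : ∀ t, 0 ≤ t → Integrable (fun x => Real.exp (-(t * u x))) π := fun t ht => by
    refine integrable_of_forall_abs_le π (C := 1) (by fun_prop) fun x => ?_
    rw [abs_of_pos (Real.exp_pos _), Real.exp_le_one_iff]
    have := mul_nonneg ht (hu0 x)
    linarith
  set M : ℝ → ℝ := fun t => ∫ x, Real.exp (-(t * u x)) ∂π with hM
  have hM0 : ∀ t, 0 ≤ M t := fun t => integral_nonneg fun x => (Real.exp_pos _).le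
  have hiter : ∀ k : ℕ, M s ≤ Real.exp 1 * M (s / 2 ^ k) ^ 2 ^ k := fun k => by
    have := le_exp_mul_pow_of_sub_sq_le (M := M) hlam hM0
      (fun t ht => integral_exp_sub_sq_le μ hlam hP hδ hB ht) k hs hs2.le
    rwa [hs2, div_self hlam.ne'] at this
  set A : Set (Fin n → X) := {x | F (WithLp.toLp 2 x) ≤ m} with hA
  have hAm : MeasurableSet A := (isClosed_le hFcont continuous_const).measurableSet
  have huA : ∀ x ∈ A, r ≤ u x := fun x hx => by
    refine le_smoothInfDist hB fun q hq => ?_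
    have h1 := hF.dist_le_mul q (WithLp.toLp 2 x)
    have h2 := le_abs_self (F q - F (WithLp.toLp 2 x))
    simp only [NNReal.coe_one, one_mul, Real.dist_eq] at h1
    rw [dist_comm] at h1
    simp only [hA, mem_ofPred_eq] at hx
    simp only [hBdef, mem_ofPred_eq] at hq
    linarith
  -- the exponential moment at small parameters, from the mass of `A`
  have hMsmall : ∀ t, 0 < t → M t ≤ Real.exp (-(t * r / (2 * (1 + t * r)))) := fun t ht => by
    have htr : 0 ≤ t * r := by positivity
    have h1 : M t ≤ ∫ x, (1 - A.indicator (fun _ => 1 - Real.exp (-(t * r))) x) ∂π := by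
      refine integral_mono (hint t ht.le)
        ((integrable_const _).sub ((integrable_const _).indicator hAm)) fun x => ?_
      by_cases hx : x ∈ A
      · simp only [indicator_of_mem hx, sub_sub_cancel]
        have := mul_le_mul_of_nonneg_left (huA x hx) ht.le
        exact Real.exp_le_exp.2 (by linarith)
      · simp only [indicator_of_notMem hx, sub_zero, Real.exp_le_one_iff]
        have := mul_nonneg ht.le (hu0 x)
        linarith
    rw [integral_sub (integrable_const _) ((integrable_const _).indicator hAm),
      integral_indicator_const _ hAm] at h1
    simp only [integral_const, probReal_univ, smul_eq_mul, one_mul] at h1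
    have h2 : Real.exp (-(t * r)) ≤ 1 / (1 + t * r) := by
      rw [Real.exp_neg, one_div]
      exact inv_anti₀ (by positivity) (by linarith [Real.add_one_le_exp (t * r)])
    have h3 : t * r / (1 + t * r) ≤ 1 - Real.exp (-(t * r)) := by
      have : t * r / (1 + t * r) = 1 - 1 / (1 + t * r) := by field_simp; ring
      linarith
    have h4 : 0 ≤ 1 - Real.exp (-(t * r)) := le_trans (by positivity) h3
    have h5 := mul_le_mul_of_nonneg_right hm h4
    have h6 := Real.add_one_le_exp (-(t * r / (2 * (1 + t * r))))
    have h7 : t * r / (2 * (1 + t * r)) = 1 / 2 * (t * r / (1 + t * r)) := by field_simp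
    linarith
  have hMs : M s ≤ Real.exp (1 - s * r / 2) := by
    have h1 : ∀ k : ℕ, M s ≤ Real.exp (1 - s * r / (2 * (1 + s / 2 ^ k * r))) := fun k => by
      refine (hiter k).trans ?_
      have h2 : M (s / 2 ^ k) ^ 2 ^ k ≤
          Real.exp (-(s / 2 ^ k * r / (2 * (1 + s / 2 ^ k * r)))) ^ 2 ^ k :=
        pow_le_pow_left₀ (hM0 _) (hMsmall _ (by positivity)) _
      refine (mul_le_mul_of_nonneg_left h2 (Real.exp_pos _).le).trans_eq ?_
      rw [← Real.exp_nat_mul, ← Real.exp_add]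
      congr 1
      have : 0 ≤ s / 2 ^ k * r := by positivity
      push_cast
      field_simp
      ring
    have h2 : Tendsto (fun k : ℕ => s / 2 ^ k) atTop (𝓝 0) :=
      tendsto_const_nhds.div_atTop (tendsto_pow_atTop_atTop_of_one_lt one_lt_two)
    have h3 : Tendsto (fun k : ℕ => Real.exp (1 - s * r / (2 * (1 + s / 2 ^ k * r)))) atTop
        (𝓝 (Real.exp (1 - s * r / (2 * (1 + 0 * r))))) := by
      refine (Real.continuous_exp.tendsto _).comp (tendsto_const_nhds.sub ?_)
      exact tendsto_const_nhds.div (((h2.mul_const r).const_add 1).const_mul 2) (by simp)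
    have := ge_of_tendsto' h3 h1
    simpa using this
  set B' : Set (Fin n → X) := {x | m + r ≤ F (WithLp.toLp 2 x)} with hB'
  have hBm : MeasurableSet B' := (isClosed_le continuous_const hFcont).measurableSet
  have hlow : π.real B' * Real.exp (-1) ≤ M s := by
    have h1 : ∫ x, B'.indicator (fun _ => Real.exp (-1)) x ∂π ≤ M s := by
      refine integral_mono ((integrable_const _).indicator hBm) (hint s hs.le) fun x => ?_
      by_cases hx : x ∈ B'
      · simp only [indicator_of_mem hx]
        have h2 : u x ≤ δ := smoothInfDist_le_of_mem hδ.le hx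
        have h3 := mul_le_mul_of_nonneg_left h2 hs.le
        have h4 : s * δ = 1 := by rw [hδdef]; field_simp
        exact Real.exp_le_exp.2 (by linarith)
      · simp only [indicator_of_notMem hx]; exact (Real.exp_pos _).le
    rwa [integral_indicator_const _ hBm, smul_eq_mul] at h1
  have h9 := hlow.trans hMs
  rw [Real.exp_neg, ← div_eq_mul_inv, div_le_iff₀ (Real.exp_pos _), ← Real.exp_add] at h9
  refine h9.trans_eq ?_
  congr 1; ring

/-! ### Upper bound for the observable diameter -/

theorem exists_median (ν : Measure ℝ) [IsProbabilityMeasure ν] :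
    ∃ m, 1 / 2 ≤ ν.real (Iic m) ∧ 1 / 2 ≤ ν.real (Ici m) := by
  set S := {x | 1 / 2 ≤ cdf ν x} with hS
  have hne : S.Nonempty :=
    ((tendsto_cdf_atTop ν).eventually (Ici_mem_nhds (by norm_num : (1 / 2 : ℝ) < 1))).exists
  have hbdd : BddBelow S := by
    obtain ⟨a, ha⟩ := ((tendsto_cdf_atBot ν).eventually
      (Iio_mem_nhds (by norm_num : (0 : ℝ) < 1 / 2))).exists
    refine ⟨a, fun x hx => ?_⟩
    by_contra hlt
    exact absurd ((monotone_cdf ν (not_le.1 hlt).le).trans_lt ha) (not_lt.2 hx)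
  refine ⟨sInf S, ?_, ?_⟩
  · rw [← cdf_eq_real, ← (cdf ν).iInf_Ioi_eq]
    have : Nonempty (Ioi (sInf S)) := nonempty_Ioi.to_subtype
    refine le_ciInf fun x => ?_
    obtain ⟨y, hy, hyx⟩ := (csInf_lt_iff hbdd hne).1 x.2
    exact le_trans hy (monotone_cdf ν hyx.le)
  · have h1 : Function.leftLim (cdf ν) (sInf S) ≤ 1 / 2 := by
      refine le_of_tendsto ((monotone_cdf ν).tendsto_leftLim _) ?_
      filter_upwards [self_mem_nhdsWithin] with x hx
      exact (not_le.1 fun h => notMem_of_lt_csInf hx hbdd h).le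
    have h2 := (cdf ν).measure_Iio (tendsto_cdf_atBot ν) (sInf S)
    rw [measure_cdf, sub_zero] at h2
    have h3 : ν.real (Iio (sInf S)) ≤ 1 / 2 := by
      rw [measureReal_def, h2]
      exact ENNReal.toReal_le_of_le_ofReal (by norm_num) (ENNReal.ofReal_le_ofReal h1)
    have h4 := probReal_compl_eq_one_sub (μ := ν) (measurableSet_Iio (a := sInf S))
    rw [compl_Iio] at h4
    linarith

theorem obsDiam_powMeasure_le {X : Type*} [MetricSpace X] [SecondCountableTopology X]
    [MeasurableSpace X] [BorelSpace X] (μ : Measure X) [IsProbabilityMeasure μ] {lam : ℝ}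
    (hlam : 0 < lam) (hP : PoincareInequality μ (ENNReal.ofReal lam)) (n : ℕ) {t : ℝ}
    (ht0 : 0 < t) (ht1 : t < 1) :
    obsDiam (powMeasure μ n) t ≤
      ENNReal.ofReal (4 * Real.log (2 * Real.exp 2 / t) / √lam) := by
  refine iSup₂_le fun F hF => ?_
  set π : Measure (Fin n → X) := Measure.pi fun _ => μ with hπ
  have hFcont : Continuous fun x : Fin n → X => F (WithLp.toLp 2 x) :=
    hF.continuous.comp (PiLp.continuous_toLp 2 _)
  have hmap : (powMeasure μ n).map F = π.map fun x => F (WithLp.toLp 2 x) := by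
    rw [powMeasure, Measure.map_map hF.continuous.measurable (WithLp.measurable_toLp 2 _)]
    rfl
  have : IsProbabilityMeasure (π.map fun x => F (WithLp.toLp 2 x)) :=
    Measure.isProbabilityMeasure_map hFcont.measurable.aemeasurable
  rw [hmap]
  have hreal : ∀ S : Set ℝ, MeasurableSet S → (π.map fun x => F (WithLp.toLp 2 x)).real S =
      π.real {x | F (WithLp.toLp 2 x) ∈ S} := fun S hS =>
    map_measureReal_apply hFcont.measurable hS
  obtain ⟨m, hm1, hm2⟩ := exists_median (π.map fun x => F (WithLp.toLp 2 x))
  have hs : 0 < √lam := Real.sqrt_pos.2 hlam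
  set r := 2 * Real.log (2 * Real.exp 2 / t) / √lam with hr
  have hr0 : 0 ≤ r := by
    refine div_nonneg (mul_nonneg zero_le_two (Real.log_nonneg ?_)) hs.le
    rw [le_div_iff₀ ht0]
    have := Real.add_one_le_exp 2
    linarith
  have hexp : Real.exp (2 - √lam * r / 2) = t / 2 := by
    have : √lam * r / 2 = Real.log (2 * Real.exp 2 / t) := by rw [hr]; field_simp
    rw [this, Real.exp_sub, Real.exp_log (by positivity)]
    have := Real.exp_pos 2
    field_simp
  have hup := measure_ge_le_exp μ hlam hP hF hr0 (by
    rw [hreal _ measurableSet_Iic] at hm1; exact hm1)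
  have hF' : LipschitzWith 1 fun p => -F p := hF.neg
  have hdown := measure_ge_le_exp μ hlam hP hF' (m := -m) hr0 (by
    rw [hreal _ measurableSet_Ici] at hm2; simpa using hm2)
  rw [hexp] at hup hdown
  have hIcc : 1 - t ≤ (π.map fun x => F (WithLp.toLp 2 x)).real (Icc (m - r) (m + r)) := by
    have h1 := probReal_compl_eq_one_sub (μ := π.map fun x => F (WithLp.toLp 2 x))
      (measurableSet_Icc (a := m - r) (b := m + r))
    have h2 : (π.map fun x => F (WithLp.toLp 2 x)).real (Icc (m - r) (m + r))ᶜ ≤ t := by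
      rw [hreal _ measurableSet_Icc.compl]
      calc π.real {x | F (WithLp.toLp 2 x) ∈ (Icc (m - r) (m + r))ᶜ}
          ≤ π.real ({x | m + r ≤ F (WithLp.toLp 2 x)} ∪
              {x | -m + r ≤ -F (WithLp.toLp 2 x)}) := by
            refine measureReal_mono fun x hx => ?_
            simp only [mem_ofPred_eq, mem_compl_iff, mem_Icc, not_and_or, not_le] at hx
            rcases hx with hx | hx
            · right; simp only [mem_ofPred_eq]; linarith
            · left; exact hx.le
        _ ≤ _ := measureReal_union_le _ _
        _ ≤ t / 2 + t / 2 := add_le_add hup hdown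
        _ = t := by ring
    linarith
  refine (iInf₂_le_of_le (Icc (m - r) (m + r)) measurableSet_Icc (iInf_le_of_le ?_ le_rfl)).trans ?_
  · rw [← ofReal_measureReal]
    exact ENNReal.ofReal_le_ofReal hIcc
  · rw [Real.ediam_Icc]
    apply ENNReal.ofReal_le_ofReal
    rw [hr]
    apply le_of_eq
    ring

theorem PoincareInequality.mono {X : Type*} [MetricSpace X] [MeasurableSpace X] {μ : Measure X}
    {a b : ℝ≥0∞} (h : PoincareInequality μ b) (hab : a ≤ b) : PoincareInequality μ a :=
  fun f hf => le_trans (by gcongr) (h f hf)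

theorem poincareInequality_poincareConst {X : Type*} [MetricSpace X] [MeasurableSpace X]
    (μ : Measure X) : PoincareInequality μ (poincareConst μ) := fun f hf => by
  rw [poincareConst, ENNReal.sSup_mul]
  exact iSup₂_le fun lam h => h f hf

theorem obsDiamSup_mul_poincareConst_le {X : Type*} [MetricSpace X] [SecondCountableTopology X]
    [MeasurableSpace X] [BorelSpace X] (μ : Measure X) [IsProbabilityMeasure μ]
    (hpos : 0 < poincareConst μ) {t : ℝ} (ht0 : 0 < t) (ht1 : t < 1) :
    obsDiamSup μ t * poincareConst μ ^ (1 / 2 : ℝ) ≤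
      ENNReal.ofReal (4 * Real.log (2 * Real.exp 2 / t)) := by
  set C := ENNReal.ofReal (4 * Real.log (2 * Real.exp 2 / t)) with hC
  have key : ∀ c : ℝ≥0, 0 < c → (c : ℝ≥0∞) ≤ poincareConst μ →
      obsDiamSup μ t * (c : ℝ≥0∞) ^ (1 / 2 : ℝ) ≤ C := fun c hc hcl => by
    have hP := (poincareInequality_poincareConst μ).mono hcl
    have hs : 0 < √(c : ℝ) := Real.sqrt_pos.2 hc
    have h1 : obsDiamSup μ t ≤ ENNReal.ofReal (4 * Real.log (2 * Real.exp 2 / t) / √(c : ℝ)) :=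
      iSup₂_le fun n _ =>
        obsDiam_powMeasure_le μ (NNReal.coe_pos.2 hc) (by simpa using hP) n ht0 ht1
    have h2 : (c : ℝ≥0∞) ^ (1 / 2 : ℝ) = ENNReal.ofReal √(c : ℝ) := by
      rw [Real.sqrt_eq_rpow, ← ENNReal.ofReal_rpow_of_pos (NNReal.coe_pos.2 hc),
        ENNReal.ofReal_coe_nnreal]
    rw [h2]
    refine (mul_le_mul_left h1 _).trans_eq ?_
    rw [← ENNReal.ofReal_mul' hs.le, div_mul_cancel₀ _ hs.ne']
  rcases eq_or_ne (obsDiamSup μ t) 0 with h0 | h0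
  · simp [h0]
  obtain ⟨c0, hc0, hc0'⟩ := ENNReal.lt_iff_exists_nnreal_btwn.1 hpos
  have htop : obsDiamSup μ t ≠ ∞ := fun h => by
    have := key c0 (by exact_mod_cast hc0) hc0'.le
    rw [h, ENNReal.top_mul (by simpa using hc0.ne')] at this
    exact absurd this (not_le.2 ENNReal.ofReal_lt_top)
  rw [mul_comm, ← ENNReal.le_div_iff_mul_le (Or.inl h0) (Or.inl htop)]
  have h1 : poincareConst μ ≤ (C / obsDiamSup μ t) ^ (2 : ℝ) := by
    refine ENNReal.le_of_forall_nnreal_lt fun c hc => ?_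
    rcases eq_or_ne c 0 with rfl | hc0
    · simp
    have h2 := key c (pos_iff_ne_zero.2 hc0) hc.le
    rw [mul_comm, ← ENNReal.le_div_iff_mul_le (Or.inl h0) (Or.inl htop)] at h2
    calc (c : ℝ≥0∞) = ((c : ℝ≥0∞) ^ (1 / 2 : ℝ)) ^ (2 : ℝ) := by
          rw [← ENNReal.rpow_mul]; norm_num
      _ ≤ _ := ENNReal.rpow_le_rpow h2 (by norm_num)
  calc poincareConst μ ^ (1 / 2 : ℝ) ≤ ((C / obsDiamSup μ t) ^ (2 : ℝ)) ^ (1 / 2 : ℝ) :=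
        ENNReal.rpow_le_rpow h1 (by norm_num)
    _ = _ := by rw [← ENNReal.rpow_mul]; norm_num

/-! ### Enlargements and the observable diameter -/

/-- If the observable diameter is less than `r`, the open `r`-neighbourhood of a closed set of
measure at least one half has measure at least `1 - t`. -/
theorem le_measure_exists_dist_lt_of_obsDiam_lt {Y : Type*} [MetricSpace Y] [MeasurableSpace Y]
    [BorelSpace Y] (ν : Measure Y) [IsProbabilityMeasure ν] {t r : ℝ} (ht : t < 1 / 2)
    (h : obsDiam ν t < ENNReal.ofReal r) {A : Set Y} (hA : IsClosed A) (hA2 : 1 / 2 ≤ ν.real A) :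
    ENNReal.ofReal (1 - t) ≤ ν {x | ∃ y ∈ A, dist x y < r} := by
  have hne : A.Nonempty := nonempty_iff_ne_empty.2 fun h0 => by
    rw [h0] at hA2; norm_num at hA2
  set F : Y → ℝ := fun x => Metric.infDist x A with hF
  have hFl : LipschitzWith 1 F := Metric.lipschitz_infDist_pt A
  have hFm : Measurable F := hFl.continuous.measurable
  have h1 : partDiam (ν.map F) t < ENNReal.ofReal r :=
    (le_iSup₂ (f := fun (f : Y → ℝ) (_ : LipschitzWith 1 f) => partDiam (ν.map f) t)
      F hFl).trans_lt h
  simp only [partDiam, iInf_lt_iff] at h1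
  obtain ⟨S, hS, hSt, hSr⟩ := h1
  rw [Measure.map_apply hFm hS] at hSt
  have h0 : (0 : ℝ) ∈ S := by
    by_contra h0
    have hsub : F ⁻¹' S ⊆ Aᶜ := fun x hx hxA => h0 (by
      have : F x = 0 := Metric.infDist_zero_of_mem hxA
      rwa [mem_preimage, this] at hx)
    have h2 : 1 - t ≤ ν.real Aᶜ := by
      rw [measureReal_def]
      exact (ENNReal.ofReal_le_iff_le_toReal (measure_ne_top _ _)).1 (hSt.trans (measure_mono hsub))
    rw [probReal_compl_eq_one_sub hA.measurableSet] at h2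
    linarith
  refine hSt.trans (measure_mono fun x hx => ?_)
  have h3 : edist (F x) 0 < ENNReal.ofReal r :=
    (Metric.edist_le_ediam_of_mem (show F x ∈ S from hx) h0).trans_lt hSr
  have h4 : F x < r := by
    rw [edist_dist, ENNReal.ofReal_lt_ofReal_iff_of_nonneg dist_nonneg, Real.dist_0_eq_abs] at h3
    exact (le_abs_self _).trans_lt h3
  exact (Metric.infDist_lt_iff hne).1 h4

theorem le_measureReal_pi_of_obsDiam_lt {X : Type*} [MetricSpace X] [SecondCountableTopology X]
    [MeasurableSpace X] [BorelSpace X] (μ : Measure X) [IsProbabilityMeasure μ] {n : ℕ}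
    {t r : ℝ} (ht : t < 1 / 2) (h : obsDiam (powMeasure μ n) t < ENNReal.ofReal r)
    {A T : Set (Fin n → X)} (hA : IsClosed A)
    (hA2 : 1 / 2 ≤ (Measure.pi fun _ : Fin n => μ).real A)
    (hT : ∀ x, ∀ y ∈ A, ∑ i, dist (x i) (y i) ^ 2 ≤ r ^ 2 → x ∈ T) :
    1 - t ≤ (Measure.pi fun _ : Fin n => μ).real T := by
  have hmt : Measurable (WithLp.toLp 2 : (Fin n → X) → PiLp 2 fun _ : Fin n => X) :=
    WithLp.measurable_toLp 2 _
  have : IsProbabilityMeasure (powMeasure μ n) :=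
    Measure.isProbabilityMeasure_map hmt.aemeasurable
  set A' : Set (PiLp 2 fun _ : Fin n => X) := WithLp.ofLp ⁻¹' A with hA'
  have hA'c : IsClosed A' := hA.preimage (PiLp.continuous_ofLp 2 _)
  have hpre : ∀ S : Set (PiLp 2 fun _ : Fin n => X), IsOpen S ∨ IsClosed S → powMeasure μ n S =
      (Measure.pi fun _ : Fin n => μ) (WithLp.toLp 2 ⁻¹' S) := fun S hS =>
    Measure.map_apply hmt (hS.elim IsOpen.measurableSet IsClosed.measurableSet)
  have h1 := le_measure_exists_dist_lt_of_obsDiam_lt (powMeasure μ n) ht h hA'c (by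
    rw [measureReal_def, hpre _ (Or.inr hA'c)]; exact hA2)
  rw [hpre] at h1
  · rw [measureReal_def]
    refine (ENNReal.ofReal_le_iff_le_toReal (measure_ne_top _ _)).1 (h1.trans (measure_mono ?_))
    rintro x ⟨y, hy, hxy⟩
    refine hT x (WithLp.ofLp y) hy ?_
    have h2 := piLp_dist_sq (WithLp.toLp 2 x) y
    rw [← h2]
    exact pow_le_pow_left₀ dist_nonneg hxy.le 2
  · left
    have : {x | ∃ y ∈ A', dist x y < r} = ⋃ y ∈ A', Metric.ball y r := by
      ext x; simp [Metric.mem_ball]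
    rw [this]
    exact isOpen_biUnion fun y _ => Metric.isOpen_ball

/-! ### The infinitesimal inf-convolution -/

/-- The rescaled decrease of `f` under inf-convolution: with
`Q f(x) = inf_z (f(z) + N d(x, z)² / (2τ))` it is `N (f(x) - Q f(x))`. -/
noncomputable def convDecrease {X : Type*} [MetricSpace X] (f : X → ℝ) (τ N : ℝ) (x : X) : ℝ :=
  ⨆ z, (N * (f x - f z) - (N * dist x z) ^ 2 / (2 * τ))

section convDecrease

variable {X : Type*} [MetricSpace X] {f : X → ℝ} {K : ℝ≥0} {τ N : ℝ}

theorem mul_sub_sq_div_le {a b : ℝ} (hτ : 0 < τ) : a * b - b ^ 2 / (2 * τ) ≤ a ^ 2 * τ / 2 := by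
  have : a ^ 2 * τ / 2 - (a * b - b ^ 2 / (2 * τ)) = (a * τ - b) ^ 2 / (2 * τ) := by
    field_simp; ring
  have h2 : 0 ≤ (a * τ - b) ^ 2 / (2 * τ) := by positivity
  linarith

theorem LipschitzWith.sub_le_mul_dist (hf : LipschitzWith K f) (x z : X) :
    f x - f z ≤ K * dist x z :=
  (le_abs_self _).trans (hf.dist_le_mul x z)

theorem convDecrease_aux (hf : LipschitzWith K f) (hτ : 0 < τ) (hN : 0 ≤ N) (x z : X) :
    N * (f x - f z) - (N * dist x z) ^ 2 / (2 * τ) ≤ K ^ 2 * τ / 2 := by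
  have h1 := mul_le_mul_of_nonneg_left (hf.sub_le_mul_dist x z) hN
  have h2 := mul_sub_sq_div_le (a := K) (b := N * dist x z) hτ
  linarith

theorem bddAbove_convDecrease (hf : LipschitzWith K f) (hτ : 0 < τ) (hN : 0 ≤ N) (x : X) :
    BddAbove (range fun z => N * (f x - f z) - (N * dist x z) ^ 2 / (2 * τ)) :=
  ⟨K ^ 2 * τ / 2, by rintro _ ⟨z, rfl⟩; exact convDecrease_aux hf hτ hN x z⟩

theorem le_convDecrease (hf : LipschitzWith K f) (hτ : 0 < τ) (hN : 0 ≤ N) (x z : X) :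
    N * (f x - f z) - (N * dist x z) ^ 2 / (2 * τ) ≤ convDecrease f τ N x :=
  le_ciSup (bddAbove_convDecrease hf hτ hN x) z

theorem convDecrease_nonneg (hf : LipschitzWith K f) (hτ : 0 < τ) (hN : 0 ≤ N) (x : X) :
    0 ≤ convDecrease f τ N x := by
  simpa using le_convDecrease hf hτ hN x x

theorem convDecrease_le (hf : LipschitzWith K f) (hτ : 0 < τ) (hN : 0 ≤ N) (x : X) :
    convDecrease f τ N x ≤ K ^ 2 * τ / 2 :=
  have : Nonempty X := ⟨x⟩
  ciSup_le fun z => convDecrease_aux hf hτ hN x z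

theorem measurable_convDecrease [MeasurableSpace X] [OpensMeasurableSpace X]
    (hf : LipschitzWith K f) (hτ : 0 < τ) (hN : 0 ≤ N) : Measurable (convDecrease f τ N) := by
  refine LowerSemicontinuous.measurable ?_
  refine lowerSemicontinuous_ciSup (bddAbove_convDecrease hf hτ hN) fun z => ?_
  have := hf.continuous
  exact Continuous.lowerSemicontinuous (by fun_prop)

/-- The Hamilton–Jacobi upper bound: as the inf-convolution becomes infinitesimal its rescaled
decrease is asymptotically at most `τ/2` times the squared descending slope. -/
theorem limsup_convDecrease_le (hf : LipschitzWith K f) (hτ : 0 < τ) {N : ℕ → ℝ}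
    (hN : ∀ n, 0 ≤ N n) (hNt : Tendsto N atTop atTop) (x : X) :
    limsup (fun n => ENNReal.ofReal (convDecrease f τ (N n) x)) atTop ≤
      ENNReal.ofReal (τ / 2) * descSlope f x ^ 2 := by
  have : Nonempty X := ⟨x⟩
  have key : ∀ a : ℝ≥0, descSlope f x < a →
      limsup (fun n => ENNReal.ofReal (convDecrease f τ (N n) x)) atTop ≤
        ENNReal.ofReal (τ / 2) * (a : ℝ≥0∞) ^ 2 := fun a ha => by
    have h1 := eventually_lt_of_limsup_lt ha
    rw [eventually_nhdsWithin_iff, Metric.eventually_nhds_iff] at h1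
    obtain ⟨ρ, hρ, h1⟩ := h1
    have h2 : ∀ y, dist x y < ρ → f x - f y ≤ a * dist x y := fun y hy => by
      rcases eq_or_ne y x with rfl | hne
      · simp
      have hd : 0 < dist y x := dist_pos.2 hne
      have h3 := h1 (y := y) (by rwa [dist_comm]) hne
      rw [edist_dist, ← ENNReal.ofReal_div_of_pos hd, ← ENNReal.ofReal_coe_nnreal] at h3
      have h4 := (ENNReal.ofReal_lt_ofReal_iff'.1 h3).1
      rw [div_lt_iff₀ hd] at h4
      rw [dist_comm]; exact h4.le
    have h5 : ∀ᶠ n in atTop, ENNReal.ofReal (convDecrease f τ (N n) x) ≤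
        ENNReal.ofReal (τ / 2) * (a : ℝ≥0∞) ^ 2 := by
      filter_upwards [hNt.eventually_ge_atTop (2 * K * τ / ρ)] with n hn
      rw [← ENNReal.ofReal_coe_nnreal, ← ENNReal.ofReal_pow a.coe_nonneg,
        ← ENNReal.ofReal_mul (by positivity)]
      apply ENNReal.ofReal_le_ofReal
      refine ciSup_le fun z => ?_
      rcases lt_or_ge (dist x z) ρ with hz | hz
      · have h6 := mul_le_mul_of_nonneg_left (h2 z hz) (hN n)
        have h7 := mul_sub_sq_div_le (a := a) (b := N n * dist x z) hτ
        linarith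
      · -- far from `x` the quadratic cost exceeds the Lipschitz gain
        have h6 := mul_le_mul_of_nonneg_left (hf.sub_le_mul_dist x z) (hN n)
        have h7 : 2 * K * τ ≤ N n * dist x z := by
          rw [div_le_iff₀ hρ] at hn
          exact hn.trans (mul_le_mul_of_nonneg_left hz (hN n))
        have h8 : K * (N n * dist x z) ≤ (N n * dist x z) ^ 2 / (2 * τ) := by
          rw [le_div_iff₀ (by positivity)]
          nlinarith [mul_nonneg (hN n) (dist_nonneg (x := x) (y := z))]
        have h9 : 0 ≤ τ / 2 * (a : ℝ) ^ 2 := by positivity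
        linarith
    exact limsup_le_of_le (h := h5)
  have hfin : descSlope f x ≠ ∞ := by
    have := descSlope_le_of_forall (φ := f) (x := x) (A := K) (C := 0) fun y => by
      have := hf.sub_le_mul_dist x y
      rw [dist_comm y x]; linarith
    exact ne_top_of_le_ne_top ENNReal.ofReal_ne_top this
  lift descSlope f x to ℝ≥0 using hfin with D hD
  have hlim : Tendsto (fun k : ℕ => ENNReal.ofReal (τ / 2) *
      ((D + 1 / ((k : ℝ≥0) + 1) : ℝ≥0) : ℝ≥0∞) ^ 2) atTop
      (𝓝 (ENNReal.ofReal (τ / 2) * ((D + 0 : ℝ≥0) : ℝ≥0∞) ^ 2)) := by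
    refine ENNReal.Tendsto.const_mul ?_ (Or.inr ENNReal.ofReal_ne_top)
    refine ((ENNReal.continuous_pow 2).tendsto _).comp (ENNReal.tendsto_coe.2 ?_)
    exact (tendsto_one_div_add_atTop_nhds_zero_nat (𝕜 := ℝ≥0)).const_add D
  rw [add_zero] at hlim
  refine ge_of_tendsto' hlim fun k => key _ ?_
  have : 0 < 1 / ((k : ℝ≥0) + 1) := by positivity
  exact_mod_cast lt_add_of_pos_right D this

end convDecrease

/-! ### Gaussian tails -/

theorem gaussTail_eq_measureReal (x : ℝ) : gaussTail x = (gaussianReal 0 1).real (Ioi x) := by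
  rw [measureReal_def, gaussianReal_apply_eq_integral _ one_ne_zero, ENNReal.toReal_ofReal
    (setIntegral_nonneg measurableSet_Ioi fun _ _ => gaussianPDFReal_nonneg _ _ _), gaussTail,
    ← integral_const_mul]
  simp [gaussianPDFReal]

theorem gaussTail_zero : gaussTail 0 = 1 / 2 := by
  have h := integral_gaussian_Ioi (1 / 2)
  have h2 : √(Real.pi / (1 / 2)) = √(2 * Real.pi) := by congr 1; ring
  have h3 : ∀ u : ℝ, -u ^ 2 / 2 = -(1 / 2) * u ^ 2 := fun u => by ring
  have h4 : 0 < √(2 * Real.pi) := Real.sqrt_pos.2 (by positivity)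
  simp only [gaussTail, h3, h, h2]
  field_simp

theorem gaussTail_sub_gaussTail {x y : ℝ} (h : x ≤ y) :
    gaussTail x - gaussTail y = (gaussianReal 0 1).real (Ioc x y) := by
  rw [gaussTail_eq_measureReal, gaussTail_eq_measureReal, ← Ioc_union_Ioi_eq_Ioi h,
    measureReal_union (by
      rw [Set.disjoint_left]; intro z hz hz'; exact absurd hz.2 (not_le.2 hz')) measurableSet_Ioi]
  ring

theorem gaussTail_lt_half {x : ℝ} (hx : 0 < x) : gaussTail x < 1 / 2 := by
  have h1 := gaussTail_sub_gaussTail hx.le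
  have h2 : 0 < (gaussianReal 0 1).real (Ioc 0 x) := by
    rw [measureReal_def, ENNReal.toReal_pos_iff]
    refine ⟨pos_iff_ne_zero.2 fun h0 => ?_, measure_lt_top _ _⟩
    have := gaussianReal_absolutelyContinuous' 0 one_ne_zero h0
    rw [Real.volume_Ioc, ENNReal.ofReal_eq_zero] at this
    linarith
  rw [gaussTail_zero] at h1
  linarith

theorem gaussTail_antitone : Antitone gaussTail := fun x y h => by
  have := gaussTail_sub_gaussTail h
  have := measureReal_nonneg (μ := gaussianReal 0 1) (s := Ioc x y)
  linarith

theorem half_sub_le_gaussTail {x : ℝ} (hx : 0 ≤ x) : 1 / 2 - x ≤ gaussTail x := by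
  have h1 := gaussTail_sub_gaussTail hx
  have h2 : (gaussianReal 0 1).real (Ioc 0 x) ≤ x := by
    rw [measureReal_def, gaussianReal_apply_eq_integral _ one_ne_zero]
    have h3 := norm_setIntegral_le_of_norm_le_const (μ := volume) (s := Ioc 0 x) (C := 1)
      (f := gaussianPDFReal 0 1) (by simp) fun u _ => by
        rw [Real.norm_of_nonneg (gaussianPDFReal_nonneg _ _ _), gaussianPDFReal]
        refine mul_le_one₀ (inv_le_one_of_one_le₀ ?_) (Real.exp_pos _).le ?_
        · rw [Real.one_le_sqrt]
          have := Real.pi_gt_three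
          simp; linarith
        · rw [Real.exp_le_one_iff, neg_div]
          simp; positivity
    rw [ENNReal.toReal_ofReal (setIntegral_nonneg measurableSet_Ioc
      fun _ _ => gaussianPDFReal_nonneg _ _ _)]
    refine (le_abs_self _).trans (h3.trans_eq ?_)
    simp [measureReal_def, hx]
  rw [gaussTail_zero] at h1
  linarith

/-- Bounds the set defining `gaussTailInv t` below by a positive number. -/
theorem half_sub_le_of_gaussTail_le {t x : ℝ} (ht : t < 1 / 2) (h : gaussTail x ≤ t) :
    1 / 2 - t ≤ x := by
  rcases le_total x 0 with hx | hx
  · have := gaussTail_antitone hx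
    rw [gaussTail_zero] at this
    linarith
  · linarith [half_sub_le_gaussTail hx]

theorem gaussTailInv_le {t x : ℝ} (ht : t < 1 / 2) (h : gaussTail x ≤ t) : gaussTailInv t ≤ x :=
  csInf_le ⟨1 / 2 - t, fun _ hy => half_sub_le_of_gaussTail_le ht hy⟩ h

theorem gaussTailInv_pos {t : ℝ} (ht0 : 0 < t) (ht : t < 1 / 2) : 0 < gaussTailInv t := by
  have hne : {x | gaussTail x ≤ t}.Nonempty := by
    have h1 : Tendsto (fun x => 1 - cdf (gaussianReal 0 1) x) atTop (𝓝 (1 - 1)) :=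
      (tendsto_cdf_atTop _).const_sub 1
    rw [sub_self] at h1
    obtain ⟨x, hx⟩ := (h1.eventually (Iio_mem_nhds ht0)).exists
    refine ⟨x, ?_⟩
    have h2 := probReal_compl_eq_one_sub (μ := gaussianReal 0 1) (measurableSet_Iic (a := x))
    rw [compl_Iic, ← gaussTail_eq_measureReal, ← cdf_eq_real] at h2
    rw [mem_ofPred_eq, h2]
    exact le_of_lt hx
  exact lt_of_lt_of_le (by linarith) (le_csInf hne fun x hx => half_sub_le_of_gaussTail_le ht hx)

/-! ### Normalized sums under product measures -/

theorem map_infinitePi_fin {X : Type*} [MeasurableSpace X] (μ : Measure X)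
    [IsProbabilityMeasure μ] (n : ℕ) :
    (Measure.infinitePi fun _ : ℕ => μ).map (fun ω (i : Fin n) => ω i) =
      Measure.pi fun _ : Fin n => μ := by
  have h : iIndepFun (fun (i : Fin n) (ω : ℕ → X) => ω i) (Measure.infinitePi fun _ : ℕ => μ) :=
    (iIndepFun_infinitePi (P := fun _ : ℕ => μ) (X := fun _ x => x)
      (fun _ => measurable_id)).precomp Fin.val_injective
  rw [(iIndepFun_iff_map_fun_eq_pi_map fun i => (measurable_pi_apply _).aemeasurable).1 h]
  congr 1
  funext i
  exact Measure.infinitePi_map_eval (fun _ : ℕ => μ) i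

theorem tendsto_measureReal_sum_le {X : Type*} [MeasurableSpace X] (μ : Measure X)
    [IsProbabilityMeasure μ] {g : X → ℝ} (hg : Measurable g) (h0 : ∫ x, g x ∂μ = 0)
    (h1 : ∫ x, g x ^ 2 ∂μ = 1) (c : ℝ) :
    Tendsto (fun n : ℕ => (Measure.pi fun _ : Fin n => μ).real
      {x | (√n)⁻¹ * ∑ i, g (x i) ≤ c}) atTop (𝓝 (1 - gaussTail c)) := by
  set P := Measure.infinitePi fun _ : ℕ => μ
  have hev : ∀ k, P.map (fun ω => ω k) = μ := fun k =>
    Measure.infinitePi_map_eval (fun _ : ℕ => μ) k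
  have hY : HasLaw (fun x : ℝ => x) (gaussianReal 0 1) (gaussianReal 0 1) :=
    ⟨aemeasurable_id, Measure.map_id⟩
  have hint : ∀ φ : X → ℝ, Measurable φ → ∀ k, ∫ ω, φ (ω k) ∂P = ∫ x, φ x ∂μ := fun φ hφ k => by
    rw [← hev k, integral_map (measurable_pi_apply k).aemeasurable hφ.aestronglyMeasurable]
  have hident : ∀ k : ℕ, IdentDistrib (fun ω : ℕ → X => g (ω k)) (fun ω => g (ω 0)) P P := fun k =>
    IdentDistrib.comp (u := g) ⟨(measurable_pi_apply k).aemeasurable,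
      (measurable_pi_apply 0).aemeasurable, by rw [hev, hev]⟩ hg
  have clt := tendstoInDistribution_inv_sqrt_mul_sum (P := P) (X := fun k ω => g (ω k)) hY
    (by rw [hint g hg]; exact h0)
    (by
      have := hint (fun x => g x ^ 2) (hg.pow_const 2) 0
      simp only [Pi.pow_apply]
      rw [this]; exact h1)
    (iIndepFun_infinitePi (P := fun _ : ℕ => μ) (X := fun _ x => g x) fun _ => hg) hident
  have h2 := ProbabilityMeasure.tendsto_measure_of_null_frontier_of_tendsto' clt.tendsto
    (E := Iic c) (by
      rw [frontier_Iic]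
      simp only [ProbabilityMeasure.coe_mk]
      rw [hY.map_eq]
      have := nullSingletonClass_gaussianReal (μ := 0) (v := 1) one_ne_zero
      simp)
  simp only [ProbabilityMeasure.coe_mk] at h2
  rw [hY.map_eq] at h2
  have h3 := (ENNReal.tendsto_toReal (measure_ne_top _ _)).comp h2
  have h4 : 1 - gaussTail c = ((gaussianReal 0 1) (Iic c)).toReal := by
    have := probReal_compl_eq_one_sub (μ := gaussianReal 0 1) (measurableSet_Ioi (a := c))
    rw [compl_Ioi, ← gaussTail_eq_measureReal] at this
    rw [← this, measureReal_def]
  rw [h4]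
  refine h3.congr fun n => ?_
  simp only [Function.comp]
  rw [Measure.map_apply_of_aemeasurable (clt.forall_aemeasurable n) measurableSet_Iic,
    measureReal_def, ← map_infinitePi_fin, Measure.map_apply (by fun_prop)
      (measurableSet_le (by fun_prop) measurable_const)]
  congr 2
  ext ω
  simp [Finset.sum_range]

/-- Chebyshev's inequality for averages of a bounded function. Since the bound involves only `C`, it
applies to functions that vary with `n`. -/
theorem measureReal_average_gt_le {X : Type*} [MeasurableSpace X] (μ : Measure X)
    [IsProbabilityMeasure μ] {R : X → ℝ} (hR : Measurable R) {C : ℝ} (h0 : ∀ x, 0 ≤ R x)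
    (hC : ∀ x, R x ≤ C) {ε : ℝ} (hε : 0 < ε) {n : ℕ} (hn : 0 < n) :
    (Measure.pi fun _ : Fin n => μ).real {x | ∫ y, R y ∂μ + ε ≤ (n : ℝ)⁻¹ * ∑ i, R (x i)} ≤
      C ^ 2 / (n * ε ^ 2) := by
  set π := Measure.pi fun _ : Fin n => μ
  have hn' : (0 : ℝ) < n := Nat.cast_pos.2 hn
  have habs : ∀ x, |R x| ≤ C := fun x => by rw [abs_of_nonneg (h0 x)]; exact hC x
  have hmem : MemLp R 2 μ := memLp_of_forall_abs_le μ hR habs 2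
  have hpull : ∀ i : Fin n, MemLp (fun x : Fin n → X => R (x i)) 2 π := fun i =>
    memLp_of_forall_abs_le π (by fun_prop) (fun x => habs _) 2
  have hvar : variance (fun x : Fin n → X => ∑ i, R (x i)) π ≤ n * C ^ 2 := by
    have h1 := variance_sum_pi (μ := fun _ : Fin n => μ) (X := fun _ => R) fun _ => hmem
    have h2 : (∑ i, fun x : Fin n → X => R (x i)) = fun x => ∑ i, R (x i) := by
      ext x; simp
    rw [h2] at h1
    have h3 : variance R μ ≤ C ^ 2 := by
      refine (variance_le_expectation_sq hR.aestronglyMeasurable).trans ?_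
      have : ∫ x, (R ^ 2) x ∂μ ≤ ∫ _, C ^ 2 ∂μ := by
        refine integral_mono hmem.integrable_sq (integrable_const _) fun x => ?_
        exact pow_le_pow_left₀ (h0 x) (hC x) 2
      simpa using this
    rw [h1]
    simpa using mul_le_mul_of_nonneg_left h3 hn'.le
  have hmean : ∫ x, ∑ i, R (x i) ∂π = n * ∫ y, R y ∂μ := by
    rw [integral_finsetSum _ fun i _ => (hpull i).integrable one_le_two]
    have : ∀ i : Fin n, ∫ x, R (x i) ∂π = ∫ y, R y ∂μ := fun i =>
      integral_comp_eval (μ := fun _ : Fin n => μ) hR.aestronglyMeasurable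
    simp [this]
  have hcheb := meas_ge_le_variance_div_sq (μ := π) (X := fun x : Fin n → X => ∑ i, R (x i))
    (memLp_finsetSum _ fun i _ => hpull i) (c := n * ε) (by positivity)
  rw [hmean] at hcheb
  have h4 : π.real {x | n * ε ≤ |∑ i, R (x i) - n * ∫ y, R y ∂μ|} ≤ n * C ^ 2 / (n * ε) ^ 2 := by
    refine ENNReal.toReal_le_of_le_ofReal (by positivity) (hcheb.trans ?_)
    exact ENNReal.ofReal_le_ofReal (by gcongr)
  refine (measureReal_mono fun x hx => ?_).trans (h4.trans_eq (by field_simp))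
  simp only [mem_ofPred_eq] at hx ⊢
  rw [inv_mul_eq_div, le_div_iff₀ hn'] at hx
  refine le_trans ?_ (le_abs_self _)
  linarith

/-! ### From dimension-free concentration to the Poincaré inequality -/

theorem descSlope_le_of_lipschitzWith {X : Type*} [MetricSpace X] {f : X → ℝ} {K : ℝ≥0}
    (hf : LipschitzWith K f) (x : X) : descSlope f x ≤ K := by
  have := descSlope_le_of_forall (φ := f) (x := x) (A := K) (C := 0) fun y => by
    have := hf.sub_le_mul_dist x y
    rw [dist_comm y x]; linarith
  simpa using this

theorem lintegral_descSlope_sq_ne_top {X : Type*} [MetricSpace X] [MeasurableSpace X]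
    (μ : Measure X) [IsProbabilityMeasure μ] {f : X → ℝ} {K : ℝ≥0} (hf : LipschitzWith K f) :
    ∫⁻ x, descSlope f x ^ 2 ∂μ ≠ ∞ := by
  refine ne_top_of_le_ne_top (b := (K : ℝ≥0∞) ^ 2) (by finiteness) ?_
  calc ∫⁻ x, descSlope f x ^ 2 ∂μ ≤ ∫⁻ _, (K : ℝ≥0∞) ^ 2 ∂μ :=
        lintegral_mono fun x => pow_le_pow_left' (descSlope_le_of_lipschitzWith hf x) 2
    _ = _ := by simp

/-- The mean rescaled decrease is asymptotically at most `τ/2` times the energy. -/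
theorem eventually_integral_convDecrease_le {X : Type*} [MetricSpace X]
    [MeasurableSpace X] [BorelSpace X] (μ : Measure X) [IsProbabilityMeasure μ]
    {f : X → ℝ} {K : ℝ≥0} (hf : LipschitzWith K f) {τ : ℝ} (hτ : 0 < τ) {N : ℕ → ℝ}
    (hN : ∀ n, 0 ≤ N n) (hNt : Tendsto N atTop atTop) {ε : ℝ} (hε : 0 < ε) :
    ∀ᶠ n in atTop, ∫ x, convDecrease f τ (N n) x ∂μ ≤
      τ / 2 * (∫⁻ x, descSlope f x ^ 2 ∂μ).toReal + ε := by
  have hE := lintegral_descSlope_sq_ne_top μ hf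
  set E := ∫⁻ x, descSlope f x ^ 2 ∂μ
  have hm : ∀ n, Measurable (convDecrease f τ (N n)) := fun n =>
    measurable_convDecrease hf hτ (hN n)
  have h1 : limsup (fun n => ∫⁻ x, ENNReal.ofReal (convDecrease f τ (N n) x) ∂μ) atTop ≤
      ENNReal.ofReal (τ / 2) * E := by
    refine (limsup_lintegral_le (fun _ => ENNReal.ofReal (K ^ 2 * τ / 2))
      (fun n => (hm n).ennreal_ofReal) (fun n => ae_of_all _ fun x =>
        ENNReal.ofReal_le_ofReal (convDecrease_le hf hτ (hN n) x)) (by simp)).trans ?_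
    rw [← lintegral_const_mul' _ _ ENNReal.ofReal_ne_top]
    exact lintegral_mono fun x => limsup_convDecrease_le hf hτ hN hNt x
  have h2 : ENNReal.ofReal (τ / 2) * E < ENNReal.ofReal (τ / 2 * E.toReal + ε) := by
    rw [ENNReal.ofReal_add (by positivity) hε.le, ENNReal.ofReal_mul (by positivity),
      ENNReal.ofReal_toReal hE]
    exact ENNReal.lt_add_right (by finiteness) (by simpa using hε)
  filter_upwards [eventually_lt_of_limsup_lt (h1.trans_lt h2)] with n hn
  rw [integral_eq_lintegral_of_nonneg_ae (ae_of_all _ fun x => convDecrease_nonneg hf hτ (hN n) x)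
    (hm n).aestronglyMeasurable]
  exact ENNReal.toReal_le_of_le_ofReal (by positivity) hn.le

/-- The central limit theorem and the Hamilton–Jacobi bound turn the enlargement property of the
half-spaces `{∑ g(xᵢ) ≤ ε √n}` into an inequality between a Gaussian quantile and the energy
of a normalized function `g`. -/
theorem gaussTailInv_le_of_obsDiam_lt {X : Type*} [MetricSpace X] [SecondCountableTopology X]
    [MeasurableSpace X] [BorelSpace X] (μ : Measure X) [IsProbabilityMeasure μ]
    {t r : ℝ} (ht : t < 1 / 2)
    (h : ∀ n, 1 ≤ n → obsDiam (powMeasure μ n) t < ENNReal.ofReal r)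
    {g : X → ℝ} {K : ℝ≥0} (hg : LipschitzWith K g) (h0 : ∫ x, g x ∂μ = 0)
    (h1 : ∫ x, g x ^ 2 ∂μ = 1) {τ : ℝ} (hτ : 0 < τ) :
    gaussTailInv t ≤ τ / 2 * (∫⁻ x, descSlope g x ^ 2 ∂μ).toReal + r ^ 2 / (2 * τ) := by
  set E := (∫⁻ x, descSlope g x ^ 2 ∂μ).toReal
  refine le_of_forall_pos_le_add fun ε' hε' => ?_
  obtain ⟨ε, hε, rfl⟩ : ∃ ε, 0 < ε ∧ ε' = 3 * ε := ⟨ε' / 3, by positivity, by ring⟩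
  set u := τ / 2 * E + r ^ 2 / (2 * τ) + 3 * ε with hu
  refine gaussTailInv_le ht ?_
  have hgm := hg.continuous.measurable
  set N : ℕ → ℝ := fun n => √n
  have hN : ∀ n, 0 ≤ N n := fun n => Real.sqrt_nonneg _
  have hNt : Tendsto N atTop atTop := Real.tendsto_sqrt_atTop.comp tendsto_natCast_atTop_atTop
  set R : ℕ → X → ℝ := fun n => convDecrease g τ (N n) with hR
  -- a positive threshold makes the half-spaces eventually have mass at least one half
  have hhalf : (1 / 2 : ℝ) < 1 - gaussTail ε := by linarith [gaussTail_lt_half hε]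
  have key : ∀ᶠ n : ℕ in atTop, 1 - t ≤ (Measure.pi fun _ : Fin n => μ).real
      {x | (√n)⁻¹ * ∑ i, g (x i) ≤ u} + (K ^ 2 * τ / 2) ^ 2 / (n * ε ^ 2) := by
    filter_upwards [(tendsto_measureReal_sum_le μ hgm h0 h1 ε).eventually (Ici_mem_nhds hhalf),
      eventually_integral_convDecrease_le μ hg hτ hN hNt hε, eventually_ge_atTop 1]
      with n hn1 hn2 hn
    have hn' : (0 : ℝ) < n := Nat.cast_pos.2 hn
    have hA : IsClosed {x : Fin n → X | (√n)⁻¹ * ∑ i, g (x i) ≤ ε} := by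
      have := hg.continuous
      exact isClosed_le (by fun_prop) continuous_const
    refine (le_measureReal_pi_of_obsDiam_lt μ ht (h n hn) hA hn1
      (T := {x | (√n)⁻¹ * ∑ i, g (x i) ≤ u} ∪
        {x | ∫ y, R n y ∂μ + ε ≤ (n : ℝ)⁻¹ * ∑ i, R n (x i)}) ?_).trans
      ((measureReal_union_le _ _).trans (add_le_add le_rfl
        (measureReal_average_gt_le μ (measurable_convDecrease hg hτ (hN n))
          (convDecrease_nonneg hg hτ (hN n)) (convDecrease_le hg hτ (hN n)) hε hn)))
    intro x y hy hxy
    by_cases hx : ∫ y, R n y ∂μ + ε ≤ (n : ℝ)⁻¹ * ∑ i, R n (x i)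
    · exact Or.inr hx
    left
    simp only [mem_ofPred_eq] at hy ⊢
    have hs : 0 < √(n : ℝ) := Real.sqrt_pos.2 hn'
    have hs2 : √(n : ℝ) ^ 2 = n := Real.sq_sqrt hn'.le
    have h3 : √(n : ℝ) * (∑ i, g (x i) - ∑ i, g (y i)) ≤
        ∑ i, R n (x i) + n * (r ^ 2 / (2 * τ)) := by
      have h4 : ∀ i, √(n : ℝ) * (g (x i) - g (y i)) ≤
          R n (x i) + n / (2 * τ) * dist (x i) (y i) ^ 2 := fun i => by
        have := le_convDecrease hg hτ (hN n) (x i) (y i)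
        simp only [N, mul_pow, hs2] at this
        have h5 : (n : ℝ) / (2 * τ) * dist (x i) (y i) ^ 2 =
            n * dist (x i) (y i) ^ 2 / (2 * τ) := by
          ring
        simp only [hR, N]
        linarith
      have h6 := Finset.sum_le_sum fun i (_ : i ∈ Finset.univ) => h4 i
      rw [← Finset.mul_sum, Finset.sum_add_distrib, ← Finset.mul_sum, Finset.sum_sub_distrib] at h6
      have h7 : (n : ℝ) / (2 * τ) * ∑ i, dist (x i) (y i) ^ 2 ≤ n / (2 * τ) * r ^ 2 := by gcongr
      have h8 : (n : ℝ) / (2 * τ) * r ^ 2 = n * (r ^ 2 / (2 * τ)) := by ring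
      linarith
    have h9 : (√(n : ℝ))⁻¹ * (∑ i, g (x i) - ∑ i, g (y i)) ≤
        (n : ℝ)⁻¹ * ∑ i, R n (x i) + r ^ 2 / (2 * τ) := by
      have h10 : (√(n : ℝ))⁻¹ * (∑ i, g (x i) - ∑ i, g (y i)) =
          (n : ℝ)⁻¹ * (√(n : ℝ) * (∑ i, g (x i) - ∑ i, g (y i))) := by
        rw [← mul_assoc, inv_mul_eq_div (n : ℝ), Real.sqrt_div_self', one_div]
      rw [h10]
      refine (mul_le_mul_of_nonneg_left h3 (inv_nonneg.2 hn'.le)).trans_eq ?_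
      field_simp
    rw [mul_sub] at h9
    push Not at hx
    linarith
  have hlim : Tendsto (fun n : ℕ => (Measure.pi fun _ : Fin n => μ).real
      {x | (√n)⁻¹ * ∑ i, g (x i) ≤ u} + (K ^ 2 * τ / 2) ^ 2 / (n * ε ^ 2)) atTop
      (𝓝 (1 - gaussTail u + 0)) :=
    (tendsto_measureReal_sum_le μ hgm h0 h1 u).add (tendsto_const_nhds.div_atTop
      (tendsto_natCast_atTop_atTop.atTop_mul_const (by positivity)))
  have := ge_of_tendsto hlim key
  linarith

theorem descSlope_mul_sub_const_le {X : Type*} [MetricSpace X] (f : X → ℝ) {c : ℝ} (hc : 0 ≤ c)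
    (m : ℝ) (x : X) :
    descSlope (fun y => c * (f y - m)) x = ENNReal.ofReal c * descSlope f x := by
  simp only [descSlope]
  rw [← ENNReal.limsup_const_mul_of_ne_top ENNReal.ofReal_ne_top]
  congr 1
  funext y
  rw [← mul_div_assoc, ← ENNReal.ofReal_mul hc]
  ring_nf

/-- The Poincaré inequality for one square integrable Lipschitz function. -/
theorem mul_evariance_le_of_memLp {X : Type*} [MetricSpace X] [SecondCountableTopology X]
    [MeasurableSpace X] [BorelSpace X] (μ : Measure X) [IsProbabilityMeasure μ]
    {t r : ℝ} (ht0 : 0 < t) (ht : t < 1 / 2) (hr : 0 < r)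
    (h : ∀ n, 1 ≤ n → obsDiam (powMeasure μ n) t < ENNReal.ofReal r)
    {f : X → ℝ} {K : ℝ≥0} (hf : LipschitzWith K f) (hf2 : MemLp f 2 μ) :
    ENNReal.ofReal ((gaussTailInv t / r) ^ 2) * evariance f μ ≤ ∫⁻ x, descSlope f x ^ 2 ∂μ := by
  rw [← ofReal_variance hf2, ← ENNReal.ofReal_mul (sq_nonneg _)]
  rcases (variance_nonneg f μ).eq_or_lt with hv | hv
  · simp [← hv]
  set v := variance f μ with hvdef
  set c := gaussTailInv t
  have hc : 0 < c := gaussTailInv_pos ht0 ht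
  have hE := lintegral_descSlope_sq_ne_top μ hf
  set E := ∫⁻ x, descSlope f x ^ 2 ∂μ with hEdef
  have hs : 0 < √v := Real.sqrt_pos.2 hv
  have hs2 : √v ^ 2 = v := Real.sq_sqrt hv.le
  have hfi : Integrable f μ := hf2.integrable one_le_two
  set m := ∫ x, f x ∂μ with hm
  set g : X → ℝ := fun x => (√v)⁻¹ * (f x - m) with hg
  have hgL : LipschitzWith (Real.toNNReal (√v)⁻¹ * K) g := by
    refine LipschitzWith.of_le_add_mul _ fun x y => ?_
    have h1 := mul_le_mul_of_nonneg_left (hf.sub_le_mul_dist x y) (inv_nonneg.2 hs.le)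
    rw [NNReal.coe_mul, Real.coe_toNNReal _ (inv_nonneg.2 hs.le)]
    simp only [hg]
    linarith
  have hg0 : ∫ x, g x ∂μ = 0 := by
    simp only [hg]
    rw [integral_const_mul, integral_sub hfi (integrable_const _)]
    simp [hm]
  have hg1 : ∫ x, g x ^ 2 ∂μ = 1 := by
    simp only [hg, mul_pow]
    rw [integral_const_mul, ← variance_eq_integral hf.continuous.aemeasurable, ← hvdef, inv_pow,
      hs2, inv_mul_cancel₀ hv.ne']
  have hgE : (∫⁻ x, descSlope g x ^ 2 ∂μ).toReal = E.toReal / v := by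
    simp only [hg, descSlope_mul_sub_const_le f (inv_nonneg.2 hs.le), mul_pow]
    rw [lintegral_const_mul' _ _ (by finiteness), ENNReal.toReal_mul, ENNReal.toReal_pow,
      ENNReal.toReal_ofReal (inv_nonneg.2 hs.le), inv_pow, hs2, ← hEdef]
    field_simp
  -- the value `r ^ 2 / c` of `τ` makes the second term equal to `c / 2`
  have hmain := gaussTailInv_le_of_obsDiam_lt μ ht h hgL hg0 hg1 (τ := r ^ 2 / c) (by positivity)
  rw [hgE] at hmain
  change c ≤ _ at hmain
  have h2 : r ^ 2 / (2 * (r ^ 2 / c)) = c / 2 := by field_simp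
  rw [h2] at hmain
  have h3 : r ^ 2 / c / 2 * (E.toReal / v) = r ^ 2 * E.toReal / (2 * c * v) := by
    field_simp
  rw [h3] at hmain
  have h4 : c / 2 ≤ r ^ 2 * E.toReal / (2 * c * v) := by linarith
  rw [le_div_iff₀ (by positivity)] at h4
  refine ENNReal.ofReal_le_of_le_toReal ?_
  rw [div_pow, div_mul_eq_mul_div, div_le_iff₀ (by positivity)]
  linarith

theorem lintegral_sub_const_sq {α : Type*} [MeasurableSpace α] (μ : Measure α)
    [IsProbabilityMeasure μ] {f : α → ℝ} (hf : MemLp f 2 μ) (c : ℝ) :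
    ∫⁻ x, ENNReal.ofReal ((f x - c) ^ 2) ∂μ =
      evariance f μ + ENNReal.ofReal ((c - ∫ x, f x ∂μ) ^ 2) := by
  have m1 : MemLp (fun x => f x - c) 2 μ := hf.sub (memLp_const _)
  have e1 := variance_eq_sub m1
  rw [variance_sub_const hf.aestronglyMeasurable, integral_sub (hf.integrable one_le_two)
    (integrable_const _)] at e1
  simp only [Pi.pow_apply, integral_const, probReal_univ, smul_eq_mul, one_mul] at e1
  rw [← ofReal_variance hf, ← ENNReal.ofReal_add (variance_nonneg _ _) (sq_nonneg _),
    ← ofReal_integral_eq_lintegral_ofReal m1.integrable_sq (ae_of_all _ fun x => sq_nonneg _)]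
  congr 1
  linarith

theorem lintegral_lintegral_sub_sq {α : Type*} [MeasurableSpace α] (μ : Measure α)
    [IsProbabilityMeasure μ] {f : α → ℝ} (hf : MemLp f 2 μ) :
    ∫⁻ y, ∫⁻ x, ENNReal.ofReal ((f x - f y) ^ 2) ∂μ ∂μ = 2 * evariance f μ := by
  simp only [lintegral_sub_const_sq μ hf]
  rw [lintegral_add_left measurable_const, ← evariance_eq_lintegral_ofReal_sub]
  simp [two_mul]

/-- The variance is lower semicontinuous under truncation. Writing it as a double integral of
`(f(x) - f(y))²` avoids the means, so that square integrability of `f` comes out as a conclusion. -/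
theorem evariance_le_of_forall_truncation {α : Type*} [MeasurableSpace α] (μ : Measure α)
    [IsProbabilityMeasure μ] {f : α → ℝ} (hf : Measurable f) {C : ℝ≥0∞} (hC : C ≠ ∞)
    (h : ∀ k : ℕ, evariance (fun x => max (-(k : ℝ)) (min (f x) k)) μ ≤ C) :
    evariance f μ ≤ C := by
  set T : ℕ → α → ℝ := fun k x => max (-(k : ℝ)) (min (f x) k) with hT
  have hTm : ∀ k, Measurable (T k) := fun k => by fun_prop
  have hTb : ∀ k x, |T k x| ≤ k := fun k x =>
    abs_le.2 ⟨le_max_left _ _, max_le (by linarith [Nat.cast_nonneg (α := ℝ) k]) (min_le_right _ _)⟩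
  have hTe : ∀ x, ∀ᶠ k : ℕ in atTop, T k x = f x := fun x => by
    filter_upwards [tendsto_natCast_atTop_atTop.eventually_ge_atTop |f x|] with k hk
    have := abs_le.1 hk
    simp only [hT]
    rw [min_eq_left this.2, max_eq_right this.1]
  have hdbl : ∀ k, ∫⁻ z : α × α, ENNReal.ofReal ((T k z.1 - T k z.2) ^ 2) ∂(μ.prod μ) ≤ 2 * C :=
    fun k => by
      have hm : Measurable fun z : α × α => ENNReal.ofReal ((T k z.1 - T k z.2) ^ 2) := by
        have := hTm k
        fun_prop
      rw [lintegral_prod_symm _ hm.aemeasurable, lintegral_lintegral_sub_sq μ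
        (memLp_of_forall_abs_le μ (hTm k) (hTb k) 2)]
      gcongr
      exact h k
  have hfm : Measurable fun z : α × α => ENNReal.ofReal ((f z.1 - f z.2) ^ 2) := by fun_prop
  have hfd : ∫⁻ z : α × α, ENNReal.ofReal ((f z.1 - f z.2) ^ 2) ∂(μ.prod μ) ≤ 2 * C := by
    calc ∫⁻ z : α × α, ENNReal.ofReal ((f z.1 - f z.2) ^ 2) ∂(μ.prod μ)
        = ∫⁻ z : α × α, liminf (fun k => ENNReal.ofReal ((T k z.1 - T k z.2) ^ 2)) atTop
            ∂(μ.prod μ) := by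
          refine lintegral_congr fun z => (Tendsto.liminf_eq ?_).symm
          refine tendsto_const_nhds.congr' ?_
          filter_upwards [hTe z.1, hTe z.2] with k h1 h2
          rw [h1, h2]
      _ ≤ liminf (fun k => ∫⁻ z : α × α, ENNReal.ofReal ((T k z.1 - T k z.2) ^ 2)
            ∂(μ.prod μ)) atTop := lintegral_liminf_le fun k => by
          have := hTm k
          fun_prop
      _ ≤ 2 * C := liminf_le_of_le (by isBoundedDefault) fun b hb => by
          obtain ⟨k, hk⟩ := hb.exists
          exact hk.trans (hdbl k)
  rw [lintegral_prod_symm _ hfm.aemeasurable] at hfd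
  have hfin : ∫⁻ y, ∫⁻ x, ENNReal.ofReal ((f x - f y) ^ 2) ∂μ ∂μ ≠ ∞ :=
    ne_top_of_le_ne_top (by finiteness) hfd
  obtain ⟨y, hy⟩ := (ae_lt_top hfm.lintegral_prod_left' hfin).exists
  have hL2 : MemLp (fun x => f x - f y) 2 μ := by
    rw [memLp_two_iff_integrable_sq (by fun_prop)]
    refine (lintegral_ofReal_ne_top_iff_integrable (by fun_prop)
      (ae_of_all _ fun x => sq_nonneg _)).1 hy.ne
  have hL2' : MemLp f 2 μ := by
    have := hL2.add (memLp_const (f y))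
    refine this.ae_eq (ae_of_all _ fun x => ?_)
    simp
  rw [lintegral_lintegral_sub_sq μ hL2'] at hfd
  exact (ENNReal.mul_le_mul_iff_right two_ne_zero ENNReal.ofNat_ne_top).1 hfd

/-- Dimension-free concentration implies the Poincaré inequality. -/
theorem poincareInequality_of_obsDiam_lt {X : Type*} [MetricSpace X] [SecondCountableTopology X]
    [MeasurableSpace X] [BorelSpace X] (μ : Measure X) [IsProbabilityMeasure μ]
    {t r : ℝ} (ht0 : 0 < t) (ht : t < 1 / 2) (hr : 0 < r)
    (h : ∀ n, 1 ≤ n → obsDiam (powMeasure μ n) t < ENNReal.ofReal r) :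
    PoincareInequality μ (ENNReal.ofReal ((gaussTailInv t / r) ^ 2)) := by
  rintro f ⟨K, hf⟩
  have hc : 0 < gaussTailInv t := gaussTailInv_pos ht0 ht
  have hpos : 0 < (gaussTailInv t / r) ^ 2 := by positivity
  have hE := lintegral_descSlope_sq_ne_top μ hf
  rw [mul_comm, ← ENNReal.le_div_iff_mul_le (Or.inl (ENNReal.ofReal_pos.2 hpos).ne')
    (Or.inl ENNReal.ofReal_ne_top)]
  refine evariance_le_of_forall_truncation μ hf.continuous.measurable
    (ENNReal.div_ne_top hE (ENNReal.ofReal_pos.2 hpos).ne') fun k => ?_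
  rw [ENNReal.le_div_iff_mul_le (Or.inl (ENNReal.ofReal_pos.2 hpos).ne')
    (Or.inl ENNReal.ofReal_ne_top), mul_comm]
  have hT : LipschitzWith K fun x => max (-(k : ℝ)) (min (f x) k) :=
    (hf.min_const k).const_max _
  refine (mul_evariance_le_of_memLp μ ht0 ht hr h hT (memLp_of_forall_abs_le μ
    hT.continuous.measurable (C := k) (fun x => abs_le.2 ⟨le_max_left _ _, max_le
      (by linarith [Nat.cast_nonneg (α := ℝ) k]) (min_le_right _ _)⟩) 2)).trans ?_
  refine lintegral_mono fun x => pow_le_pow_left' ?_ 2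
  refine limsup_le_limsup (Eventually.of_forall fun y => ?_)
  refine ENNReal.div_le_div_right ?_ _
  rcases le_total (f x) (f y) with hxy | hxy
  · have : max (-(k : ℝ)) (min (f x) k) ≤ max (-(k : ℝ)) (min (f y) k) := by gcongr
    rw [ENNReal.ofReal_of_nonpos (by linarith)]
    exact zero_le
  · apply ENNReal.ofReal_le_ofReal
    rcases le_total (f x) k with h1 | h1 <;> rcases le_total (f y) k with h2 | h2 <;>
    rcases le_total (-(k : ℝ)) (f x) with h3 | h3 <;>
    rcases le_total (-(k : ℝ)) (f y) with h4 | h4 <;>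
    simp only [min_def, max_def] <;> split_ifs <;> linarith

/-- A measure satisfying the Poincaré inequality with infinite constant is a Dirac mass: all
distance functions have zero variance. -/
theorem exists_eq_dirac_of_poincareInequality_top {X : Type*} [MetricSpace X]
    [SecondCountableTopology X] [MeasurableSpace X] [BorelSpace X] (μ : Measure X)
    [IsProbabilityMeasure μ] (h : PoincareInequality μ ∞) : ∃ x, μ = Measure.dirac x := by
  have : Nonempty X := μ.nonempty_of_neZero
  have hd : ∀ k : ℕ, ∀ᵐ x ∂μ, dist x (TopologicalSpace.denseSeq X k) =
      ∫ y, dist y (TopologicalSpace.denseSeq X k) ∂μ := fun k => by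
    have hL := LipschitzWith.dist_left (TopologicalSpace.denseSeq X k)
    have h1 := h _ ⟨1, hL⟩
    have h2 : evariance (fun x => dist x (TopologicalSpace.denseSeq X k)) μ = 0 := by
      by_contra h0
      rw [ENNReal.top_mul h0, top_le_iff] at h1
      exact lintegral_descSlope_sq_ne_top μ hL h1
    exact (evariance_eq_zero_iff hL.continuous.aemeasurable).1 h2
  have hall := ae_all_iff.2 hd
  obtain ⟨x0, hx0⟩ := hall.exists
  refine ⟨x0, ?_⟩
  have hae : ∀ᵐ x ∂μ, x = x0 := by
    filter_upwards [hall] with x hx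
    have hcl : ∀ z, dist x z = dist x0 z := by
      have hc1 : Continuous fun z => dist x z := by fun_prop
      have hc2 : Continuous fun z => dist x0 z := by fun_prop
      have := hc1.ext_on (TopologicalSpace.denseRange_denseSeq X) hc2 (by
        rintro _ ⟨k, rfl⟩
        simp only [hx k, hx0 k])
      exact fun z => congrFun this z
    have := hcl x0
    rwa [dist_self, dist_eq_zero] at this
  ext s hs
  rw [Measure.dirac_apply' _ hs]
  by_cases hxs : x0 ∈ s
  · rw [indicator_of_mem hxs, Pi.one_apply, ← mem_ae_iff_prob_eq_one hs]
    filter_upwards [hae] with x hx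
    rwa [hx]
  · rw [indicator_of_notMem hxs]
    refine measure_mono_null (fun x hx => ?_) (ae_iff.1 hae)
    rintro rfl
    exact hxs hx

/-! ### The comparison -/

theorem poincareInequality_of_obsDiamSup_lt {X : Type*} [MetricSpace X] [SecondCountableTopology X]
    [MeasurableSpace X] [BorelSpace X] (μ : Measure X) [IsProbabilityMeasure μ] {t : ℝ}
    (ht0 : 0 < t) (ht : t < 1 / 2) {r : ℝ} (hr : 0 < r)
    (h : obsDiamSup μ t < ENNReal.ofReal r) :
    PoincareInequality μ (ENNReal.ofReal ((gaussTailInv t / r) ^ 2)) :=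
  poincareInequality_of_obsDiam_lt μ ht0 ht hr fun n hn =>
    (le_iSup₂ (f := fun (n : ℕ) (_ : 1 ≤ n) => obsDiam (powMeasure μ n) t) n hn).trans_lt h

theorem gaussTailInv_le_obsDiamSup_mul {X : Type*} [MetricSpace X] [SecondCountableTopology X]
    [MeasurableSpace X] [BorelSpace X] (μ : Measure X) [IsProbabilityMeasure μ]
    (hpos : 0 < poincareConst μ) (hμ : ¬ ∃ x : X, μ = Measure.dirac x) {t : ℝ}
    (ht0 : 0 < t) (ht : t < 1 / 2) :
    ENNReal.ofReal (gaussTailInv t) ≤ obsDiamSup μ t * poincareConst μ ^ (1 / 2 : ℝ) := by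
  have hc : 0 < gaussTailInv t := gaussTailInv_pos ht0 ht
  have htop : poincareConst μ ≠ ∞ := fun h =>
    hμ (exists_eq_dirac_of_poincareInequality_top μ (h ▸ poincareInequality_poincareConst μ))
  have hL0 : poincareConst μ ^ (1 / 2 : ℝ) ≠ 0 := (ENNReal.rpow_pos hpos htop).ne'
  have hLtop : poincareConst μ ^ (1 / 2 : ℝ) ≠ ∞ :=
    ENNReal.rpow_ne_top_of_nonneg (by norm_num) htop
  rw [← ENNReal.div_le_iff hL0 hLtop]
  refine le_of_forall_gt_imp_ge_of_dense fun a ha => ?_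
  rcases eq_or_ne a ∞ with rfl | hatop
  · exact le_top
  lift a to ℝ≥0 using hatop
  have ha0 : 0 < (a : ℝ) := by
    have : (0 : ℝ≥0∞) < a := zero_le.trans_lt ha
    exact_mod_cast this
  have h1 : ENNReal.ofReal ((gaussTailInv t / a) ^ 2) ≤ poincareConst μ :=
    le_sSup (poincareInequality_of_obsDiamSup_lt μ ht0 ht ha0 (by simpa using ha))
  have h2 := ENNReal.rpow_le_rpow h1 (show (0 : ℝ) ≤ 1 / 2 by norm_num)
  rw [ENNReal.ofReal_rpow_of_pos (by positivity), ← Real.sqrt_eq_rpow,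
    Real.sqrt_sq (by positivity), ENNReal.ofReal_div_of_pos ha0, ENNReal.ofReal_coe_nnreal] at h2
  have ha0' : (a : ℝ≥0∞) ≠ 0 := by exact_mod_cast ha0.ne'
  rw [ENNReal.div_le_iff hL0 hLtop, mul_comm]
  exact (ENNReal.div_le_iff ha0' ENNReal.coe_ne_top).1 h2

theorem corollary1p6 :
    ∃ a b : ℝ, 0 < a ∧ 1 ≤ b ∧
      ∀ (X : Type*) [MetricSpace X] [CompleteSpace X] [SecondCountableTopology X]
        [MeasurableSpace X] [BorelSpace X] (μ : Measure X) [IsProbabilityMeasure μ],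
        -- the optimal constant is itself admissible
        PoincareInequality μ (poincareConst μ) ∧
        -- the Poincaré inequality and boundedness of the observable diameters
        ((∃ lam : ℝ≥0∞, 0 < lam ∧ PoincareInequality μ lam) ↔
          ∃ t ∈ Ioo (0 : ℝ) (1 / 2), obsDiamSup μ t < ∞) ∧
        -- the quantitative comparison
        (0 < poincareConst μ → ∀ t ∈ Ioo (0 : ℝ) (1 / 2),
          ((¬ ∃ x : X, μ = Measure.dirac x) →
            ENNReal.ofReal (gaussTailInv t) ≤ obsDiamSup μ t * poincareConst μ ^ (1 / 2 : ℝ)) ∧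
          obsDiamSup μ t * poincareConst μ ^ (1 / 2 : ℝ) ≤
            ENNReal.ofReal (a * Real.log (b / t))) := by
  refine ⟨4, 2 * Real.exp 2, by norm_num, by linarith [Real.add_one_le_exp 2], ?_⟩
  intro X _ _ _ _ _ μ _
  have hadm : PoincareInequality μ (poincareConst μ) := poincareInequality_poincareConst μ
  have hup : 0 < poincareConst μ → ∀ t ∈ Ioo (0 : ℝ) (1 / 2),
      obsDiamSup μ t * poincareConst μ ^ (1 / 2 : ℝ) ≤
        ENNReal.ofReal (4 * Real.log (2 * Real.exp 2 / t)) := fun hpos t ht =>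
    obsDiamSup_mul_poincareConst_le μ hpos ht.1 (by linarith [ht.2])
  refine ⟨hadm, ⟨?_, ?_⟩, fun hpos t ht =>
    ⟨fun hμ => gaussTailInv_le_obsDiamSup_mul μ hpos hμ ht.1 ht.2, hup hpos t ht⟩⟩
  · rintro ⟨lam, hlam, hP⟩
    have hpos : 0 < poincareConst μ := hlam.trans_le (le_sSup hP)
    refine ⟨1 / 4, by norm_num, lt_top_iff_ne_top.2 fun h => ?_⟩
    have h1 := hup hpos (1 / 4) (by norm_num)
    have h2 : poincareConst μ ^ (1 / 2 : ℝ) ≠ 0 := by simp [hpos.ne']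
    rw [h, ENNReal.top_mul h2] at h1
    exact not_le.2 ENNReal.ofReal_lt_top h1
  · rintro ⟨t, ht, hfin⟩
    obtain ⟨r, hr, -⟩ := ENNReal.lt_iff_exists_nnreal_btwn.1 hfin
    have hr0 : 0 < (r : ℝ) := by
      have : (0 : ℝ≥0∞) < r := zero_le.trans_lt hr
      exact_mod_cast this
    have hc := gaussTailInv_pos ht.1 ht.2
    exact ⟨_, ENNReal.ofReal_pos.2 (by positivity),
      poincareInequality_of_obsDiamSup_lt μ ht.1 ht.2 hr0 (by simpa using hr)⟩
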